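/- Let $E=\mathbb{C}^m$ carry a Hermitian inner product, and let $\beta=(\beta_1,\dots,\beta_n)$ with $\beta_k\in\{1,\dots,m-1\}$. On $E\otimes z^{-1}\mathbb{C}[z^{-1}]=E\otimes\mathbb{C}((z))/\mathbb{C}[[z]]$ use the operator of multiplication by $z$ and the inner product $\langle v\otimes z^k,w\otimes z^l\rangle=\delta_{k,l}\langle v,w\rangle$. Let $Y_\beta$ be the set of chains of subspaces $0=L_0\subset L_1\subset\dots\subset L_n\subset E\otimes z^{-1}\mathbb{C}[z^{-1}]$ with $\dim(L_k/L_{k-1})=\beta_k$ and $zL_k\subset L_{k-1}$ for all $k$. Every $L_k$ lies in $V_n=E\otimes\mathrm{span}(z^{-1},\dots,z^{-n})$, so $Y_\beta\subset\prod_{k}Gr(\beta_1+\dots+\beta_k,V_n)$. For $1\le i\le n-1$ let $X^i_\beta\subset Y_\beta$ be the set of chains with $zL_{i+1}\subset L_{i-1}$ if $\beta_i+\beta_{i+1}\le m$, and with $L_{i-1}\subset zL_{i+1}$ and $\ker z\subset L_{i+1}$ if $\beta_i+\beta_{i+1}\ge m$ (for $\beta_i+\beta_{i+1}=m$ the two agree).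 Let $A^i_\beta\subset\prod_k Gr(\beta_k,E)$ be the set of tuples $(l_1,\dots,l_n)$ such that $l_i$ and $l_{i+1}$ are perpendicular, which means $l_i\perp l_{i+1}$ if $\beta_i+\beta_{i+1}\le m$, and $l_i^\perp\perp l_{i+1}^\perp$ if $\beta_i+\beta_{i+1}\ge m$ (again the two agree in the common case). Let $C:E\otimes z^{-1}\mathbb{C}[z^{-1}]\to E$, $C\bigl(\sum_k v_kz^{-k}\bigr)=\sum_k v_k$, i.e. $C(v)=\operatorname{Res}_{z=0}\frac{v(z)\,dz}{1-z}$. **Theorem.** $Y_\beta$ and all $X^i_\beta$ are smooth submanifolds of $\prod_k Gr(\beta_1+\dots+\beta_k,V_n)$, and all $A^i_\beta$ are smooth submanifolds of $\prod_kGr(\beta_k,E)$. The map $$\Phi:Y_\beta\to\prod_{k=1}^nGr(\beta_k,E),\qquad (L_1,\dots,L_n)\mapsto\bigl(C(L_k\cap L_{k-1}^\perp)\bigr)_{k=1}^n,$$ is well defined and a diffeomorphism, and $\Phi(X^i_\beta)=A^i_\beta$ for $1\le i\le n-1$. Moreover, for all $i\ne j$ in $\{1,\dots,n-1\}$, $X^i_\beta$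 and $X^j_\beta$ meet transversely in $Y_\beta$. -/

import Mathlib

open scoped Manifold ContDiff

noncomputable section

/-! ### Grassmannians as smooth manifolds -/

/-- The Grassmannian `Gr(k, V)` of `k`-dimensional linear subspaces of a complex vector space. -/
structure Grass (k : ℕ) (V : Type*) [AddCommGroup V] [Module ℂ V] where
  carrier : Submodule ℂ V
  finrank_eq : Module.finrank ℂ carrier = k

namespace Grass

/-- The model space `Hom(ℂ^k, ℂ^d)` of a Grassmannian of `k`-planes in a space of dimension
`k + d`, with the operator norm. -/
abbrev Model (k d : ℕ) : Type := (Fin k → ℂ) →L[ℂ] (Fin d → ℂ)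

variable {k : ℕ} {V : Type*} [AddCommGroup V] [Module ℂ V] {d : ℕ}

/-- The `k`-plane in `V` which a linear coordinate system `φ : V ≃ ℂ^k × ℂ^d` identifies with the
graph of the linear map `A : ℂ^k → ℂ^d`. -/
def ofGraph (φ : V ≃ₗ[ℂ] (Fin k → ℂ) × (Fin d → ℂ)) (A : Model k d) : Grass k V where
  carrier := (A : (Fin k → ℂ) →ₗ[ℂ] (Fin d → ℂ)).graph.map (φ.symm : _ →ₗ[ℂ] V)
  finrank_eq := by
    rw [LinearMap.graph_eq_range_prod, ← LinearMap.range_comp]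
    rw [LinearMap.finrank_range_of_inj]
    · simp
    · intro x y h
      have h' := φ.symm.injective h
      exact congrArg Prod.fst h'

theorem mem_ofGraph (φ : V ≃ₗ[ℂ] (Fin k → ℂ) × (Fin d → ℂ)) (A : Model k d) (v : V) :
    v ∈ (ofGraph φ A).carrier ↔ (φ v).2 = A (φ v).1 := by
  simp only [ofGraph, Submodule.mem_map, LinearMap.mem_graph_iff]
  constructor
  · rintro ⟨p, hp, rfl⟩
    simpa using hp
  · intro h
    exact ⟨φ v, h, by simp⟩

theorem ext' {W W' : Grass k V} (h : W.carrier = W'.carrier) : W = W' := by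
  cases W; cases W'; cases h; rfl

theorem ofGraph_injective (φ : V ≃ₗ[ℂ] (Fin k → ℂ) × (Fin d → ℂ)) :
    Function.Injective (ofGraph φ) := by
  intro A B h
  ext1 x
  have h1 : φ.symm (x, A x) ∈ (ofGraph φ A).carrier := by rw [mem_ofGraph]; simp
  rw [h, mem_ofGraph] at h1
  simpa using h1

/-- The graph chart of `Gr(k, V)` attached to a coordinate system `φ : V ≃ ℂ^k × ℂ^d`: it is
defined on the planes that are graphs over `ℂ^k`, and sends such a plane to the linear map
`ℂ^k → ℂ^d` of which it is the graph. -/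
def chart (φ : V ≃ₗ[ℂ] (Fin k → ℂ) × (Fin d → ℂ)) : PartialEquiv (Grass k V) (Model k d) :=
  ((ofGraph_injective φ).injOn.toPartialEquiv (ofGraph φ) Set.univ).symm

theorem chart_symm_apply (φ : V ≃ₗ[ℂ] (Fin k → ℂ) × (Fin d → ℂ)) (A : Model k d) :
    (chart φ).symm A = ofGraph φ A := rfl

theorem chart_source (φ : V ≃ₗ[ℂ] (Fin k → ℂ) × (Fin d → ℂ)) :
    (chart φ).source = Set.range (ofGraph φ) := by
  change ofGraph φ '' Set.univ = _
  exact Set.image_univ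

theorem chart_target (φ : V ≃ₗ[ℂ] (Fin k → ℂ) × (Fin d → ℂ)) :
    (chart φ).target = Set.univ := rfl

theorem chart_ofGraph (φ : V ≃ₗ[ℂ] (Fin k → ℂ) × (Fin d → ℂ)) (A : Model k d) :
    chart φ (ofGraph φ A) = A :=
  (chart φ).right_inv (Set.mem_univ A)

/-- The change of coordinates between two coordinate systems. -/
def transMap (φ φ' : V ≃ₗ[ℂ] (Fin k → ℂ) × (Fin d → ℂ)) :
    (Fin k → ℂ) × (Fin d → ℂ) →L[ℂ] (Fin k → ℂ) × (Fin d → ℂ) :=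
  LinearMap.toContinuousLinearMap (φ.symm.trans φ').toLinearMap

/-- The first component of the change of coordinates on the graph of `A`. -/
def transFst (φ φ' : V ≃ₗ[ℂ] (Fin k → ℂ) × (Fin d → ℂ)) (A : Model k d) :
    (Fin k → ℂ) →L[ℂ] (Fin k → ℂ) :=
  ((ContinuousLinearMap.fst ℂ (Fin k → ℂ) (Fin d → ℂ)).comp (transMap φ φ')).comp
    ((ContinuousLinearMap.id ℂ (Fin k → ℂ)).prod A)

/-- The second component of the change of coordinates on the graph of `A`. -/
def transSnd (φ φ' : V ≃ₗ[ℂ] (Fin k → ℂ) × (Fin d → ℂ)) (A : Model k d) : Model k d :=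
  ((ContinuousLinearMap.snd ℂ (Fin k → ℂ) (Fin d → ℂ)).comp (transMap φ φ')).comp
    ((ContinuousLinearMap.id ℂ (Fin k → ℂ)).prod A)

theorem transFst_apply (φ φ' : V ≃ₗ[ℂ] (Fin k → ℂ) × (Fin d → ℂ)) (A : Model k d)
    (x : Fin k → ℂ) : transFst φ φ' A x = (φ' (φ.symm (x, A x))).1 := rfl

theorem transSnd_apply (φ φ' : V ≃ₗ[ℂ] (Fin k → ℂ) × (Fin d → ℂ)) (A : Model k d)
    (x : Fin k → ℂ) : transSnd φ φ' A x = (φ' (φ.symm (x, A x))).2 := rfl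

theorem contDiff_idProd : ContDiff ℝ ∞
    (fun A : Model k d ↦ (ContinuousLinearMap.id ℂ (Fin k → ℂ)).prod A) := by
  have h : ∀ A : Model k d, (ContinuousLinearMap.id ℂ (Fin k → ℂ)).prod A =
      (ContinuousLinearMap.inl ℂ (Fin k → ℂ) (Fin d → ℂ)).comp (ContinuousLinearMap.id ℂ _) +
        (ContinuousLinearMap.inr ℂ (Fin k → ℂ) (Fin d → ℂ)).comp A := by
    intro A
    ext1 x
    apply Prod.ext <;> simp
  simp_rw [h]
  refine contDiff_const.add ?_
  exact ((ContinuousLinearMap.compL ℂ (Fin k → ℂ) (Fin d → ℂ) ((Fin k → ℂ) × (Fin d → ℂ))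
    (ContinuousLinearMap.inr ℂ (Fin k → ℂ) (Fin d → ℂ))).contDiff (n := ∞)).restrict_scalars ℝ

theorem contDiff_transFst (φ φ' : V ≃ₗ[ℂ] (Fin k → ℂ) × (Fin d → ℂ)) :
    ContDiff ℝ ∞ (transFst φ φ') :=
  (((ContinuousLinearMap.compL ℂ (Fin k → ℂ) ((Fin k → ℂ) × (Fin d → ℂ)) (Fin k → ℂ)
    ((ContinuousLinearMap.fst ℂ (Fin k → ℂ) (Fin d → ℂ)).comp (transMap φ φ'))).contDiff
      (n := ∞)).restrict_scalars ℝ).comp contDiff_idProd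

theorem contDiff_transSnd (φ φ' : V ≃ₗ[ℂ] (Fin k → ℂ) × (Fin d → ℂ)) :
    ContDiff ℝ ∞ (transSnd φ φ') :=
  (((ContinuousLinearMap.compL ℂ (Fin k → ℂ) ((Fin k → ℂ) × (Fin d → ℂ)) (Fin d → ℂ)
    ((ContinuousLinearMap.snd ℂ (Fin k → ℂ) (Fin d → ℂ)).comp (transMap φ φ'))).contDiff
      (n := ∞)).restrict_scalars ℝ).comp contDiff_idProd

theorem ofGraph_eq_iff (φ φ' : V ≃ₗ[ℂ] (Fin k → ℂ) × (Fin d → ℂ)) (A B : Model k d) :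
    ofGraph φ A = ofGraph φ' B ↔ transSnd φ φ' A = B.comp (transFst φ φ' A) := by
  constructor
  · intro h
    ext1 x
    have h1 : φ.symm (x, A x) ∈ (ofGraph φ A).carrier := by rw [mem_ofGraph]; simp
    rw [h, mem_ofGraph] at h1
    simpa [transFst_apply, transSnd_apply] using h1
  · intro h
    have hle : (ofGraph φ A).carrier ≤ (ofGraph φ' B).carrier := by
      intro v hv
      rw [mem_ofGraph] at hv ⊢
      have h1 := congrArg (fun T : Model k d ↦ T (φ v).1) h
      simp only [transSnd_apply, ContinuousLinearMap.comp_apply, transFst_apply] at h1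
      rw [← hv] at h1
      simpa using h1
    have : FiniteDimensional ℂ V := φ.symm.finiteDimensional
    exact ext' (Submodule.eq_of_le_of_finrank_eq hle
      ((ofGraph φ A).finrank_eq.trans (ofGraph φ' B).finrank_eq.symm))

theorem ofGraph_mem_range_iff (φ φ' : V ≃ₗ[ℂ] (Fin k → ℂ) × (Fin d → ℂ)) (A : Model k d) :
    ofGraph φ A ∈ Set.range (ofGraph φ') ↔ IsUnit (transFst φ φ' A) := by
  constructor
  · rintro ⟨B, hB⟩
    rw [eq_comm, ofGraph_eq_iff] at hB
    have hinj : Function.Injective (transFst φ φ' A) := by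
      rw [injective_iff_map_eq_zero]
      intro x hx
      have h2 : transSnd φ φ' A x = 0 := by rw [hB]; simp [hx]
      have h3 : φ' (φ.symm (x, A x)) = 0 := Prod.ext (by rw [← transFst_apply]; exact hx) (by rw [← transSnd_apply]; exact h2)
      have h4 : (x, A x) = (0 : (Fin k → ℂ) × (Fin d → ℂ)) := by simpa using h3
      exact congrArg Prod.fst h4
    rw [ContinuousLinearMap.isUnit_iff_bijective]
    exact ⟨hinj, LinearMap.injective_iff_surjective (f := (transFst φ φ' A).toLinearMap).1 hinj⟩
  · intro h
    refine ⟨(transSnd φ φ' A).comp (Ring.inverse (transFst φ φ' A)), ?_⟩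
    rw [eq_comm, ofGraph_eq_iff, ContinuousLinearMap.comp_assoc]
    have h1 : (Ring.inverse (transFst φ φ' A)).comp (transFst φ φ' A) =
        ContinuousLinearMap.id ℂ _ := Ring.inverse_mul_cancel _ h
    rw [h1]; rfl

theorem trans_source (φ φ' : V ≃ₗ[ℂ] (Fin k → ℂ) × (Fin d → ℂ)) :
    ((chart φ).symm.trans (chart φ')).source = {A | IsUnit (transFst φ φ' A)} := by
  ext A
  rw [PartialEquiv.trans_source, chart_source]
  simp only [PartialEquiv.symm_source, chart_target, Set.univ_inter, Set.mem_preimage,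
    chart_symm_apply, ofGraph_mem_range_iff, Set.mem_ofPred_eq]

theorem trans_apply (φ φ' : V ≃ₗ[ℂ] (Fin k → ℂ) × (Fin d → ℂ)) (A : Model k d)
    (h : IsUnit (transFst φ φ' A)) : (chart φ).symm.trans (chart φ') A =
      (transSnd φ φ' A).comp (Ring.inverse (transFst φ φ' A)) := by
  have h1 : ofGraph φ A = ofGraph φ' ((transSnd φ φ' A).comp (Ring.inverse (transFst φ φ' A))) := by
    rw [ofGraph_eq_iff, ContinuousLinearMap.comp_assoc]
    have h1 : (Ring.inverse (transFst φ φ' A)).comp (transFst φ φ' A) =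
        ContinuousLinearMap.id ℂ _ := Ring.inverse_mul_cancel _ h
    rw [h1]; rfl
  change chart φ' (ofGraph φ A) = _
  rw [h1, chart_ofGraph]

theorem isOpen_trans_source (φ φ' : V ≃ₗ[ℂ] (Fin k → ℂ) × (Fin d → ℂ)) :
    IsOpen ((chart φ).symm.trans (chart φ')).source := by
  rw [trans_source]
  exact Units.isOpen.preimage (contDiff_transFst φ φ').continuous

theorem contDiffOn_trans (φ φ' : V ≃ₗ[ℂ] (Fin k → ℂ) × (Fin d → ℂ)) :
    ContDiffOn ℝ ∞ ((chart φ).symm.trans (chart φ')) ((chart φ).symm.trans (chart φ')).source := by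
  rw [trans_source]
  have h : ContDiffOn ℝ ∞
      (fun A ↦ (transSnd φ φ' A).comp (Ring.inverse (transFst φ φ' A)))
      {A | IsUnit (transFst φ φ' A)} := by
    intro A hA
    obtain ⟨u, hu⟩ := hA
    have h1 : ContDiffAt ℝ ∞ (fun A ↦ Ring.inverse (transFst φ φ' A)) A := by
      have h2 := (contDiffAt_ringInverse ℂ (n := ∞) u).restrict_scalars ℝ
      rw [hu] at h2
      exact h2.comp A (contDiff_transFst φ φ').contDiffAt
    have h3 : ContDiff ℝ ∞ (fun p : Model k d × ((Fin k → ℂ) →L[ℂ] (Fin k → ℂ)) ↦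
        p.1.comp p.2) :=
      (ContDiff.clm_comp (𝕜 := ℂ) contDiff_fst contDiff_snd).restrict_scalars ℝ
    exact (h3.contDiffAt.comp A ((contDiff_transSnd φ φ').contDiffAt.prodMk h1)).contDiffWithinAt
  exact h.congr fun A hA ↦ trans_apply φ φ' A hA

variable [FiniteDimensional ℂ V]

/-- Every `k`-plane lies in the domain of some graph chart. -/
theorem exists_chart (W : Grass k V) :
    ∃ φ : V ≃ₗ[ℂ] (Fin k → ℂ) × (Fin (Module.finrank ℂ V - k) → ℂ), W ∈ (chart φ).source := by
  obtain ⟨Q, hQ⟩ := Submodule.exists_isCompl W.carrier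
  have hd : Module.finrank ℂ Q = Module.finrank ℂ V - k := by
    have := Submodule.finrank_add_eq_of_isCompl hQ
    rw [W.finrank_eq] at this
    omega
  let e₁ : W.carrier ≃ₗ[ℂ] (Fin k → ℂ) := LinearEquiv.ofFinrankEq _ _ (by simp [W.finrank_eq])
  let e₂ : Q ≃ₗ[ℂ] (Fin (Module.finrank ℂ V - k) → ℂ) :=
    LinearEquiv.ofFinrankEq _ _ (by simp [hd])
  let φ := (Submodule.prodEquivOfIsCompl _ _ hQ).symm.trans (e₁.prodCongr e₂)
  refine ⟨φ, ?_⟩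
  rw [chart_source]
  refine ⟨0, ext' (Submodule.eq_of_le_of_finrank_eq ?_
    ((ofGraph φ 0).finrank_eq.trans W.finrank_eq.symm))⟩
  intro v hv
  rw [mem_ofGraph] at hv
  have h : ((Submodule.prodEquivOfIsCompl _ _ hQ).symm v).2 = 0 := by
    simpa [φ] using hv
  exact (Submodule.prodEquivOfIsCompl_symm_apply_snd_eq_zero W.carrier Q hQ).1 h

/-- The standard atlas of the Grassmannian: all graph charts. -/
def chartedSpaceCore (k : ℕ) (V : Type*) [AddCommGroup V] [Module ℂ V] [FiniteDimensional ℂ V] :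
    ChartedSpaceCore (Model k (Module.finrank ℂ V - k)) (Grass k V) where
  atlas := Set.range chart
  chartAt W := chart (exists_chart W).choose
  mem_chart_source W := (exists_chart W).choose_spec
  chart_mem_atlas _ := Set.mem_range_self _
  open_source := by
    rintro _ _ ⟨φ, rfl⟩ ⟨φ', rfl⟩
    exact isOpen_trans_source φ φ'
  continuousOn_toFun := by
    rintro _ _ ⟨φ, rfl⟩ ⟨φ', rfl⟩
    exact (contDiffOn_trans φ φ').continuousOn

instance : TopologicalSpace (Grass k V) := (chartedSpaceCore k V).toTopologicalSpace

instance : ChartedSpace (Model k (Module.finrank ℂ V - k)) (Grass k V) :=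
  (chartedSpaceCore k V).toChartedSpace

instance : IsManifold 𝓘(ℝ, Model k (Module.finrank ℂ V - k)) ∞ (Grass k V) := by
  apply isManifold_of_contDiffOn
  intro e e' he he'
  change e ∈ ⋃ (e : PartialEquiv _ _) (he : e ∈ (chartedSpaceCore k V).atlas),
    {(chartedSpaceCore k V).openPartialHomeomorph e he} at he
  change e' ∈ ⋃ (e : PartialEquiv _ _) (he : e ∈ (chartedSpaceCore k V).atlas),
    {(chartedSpaceCore k V).openPartialHomeomorph e he} at he'
  simp only [Set.mem_iUnion, Set.mem_singleton_iff] at he he'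
  obtain ⟨_, ⟨φ, rfl⟩, rfl⟩ := he
  obtain ⟨_, ⟨φ', rfl⟩, rfl⟩ := he'
  refine (contDiffOn_trans φ φ').mono ?_
  intro A hA
  exact hA.1

end Grass

/-- A finite product `∏ᵢ Gr(dᵢ, V)` of Grassmannians, with the product manifold structure. -/
abbrev GrassProd {ι : Type*} (d : ι → ℕ) (V : Type*) [AddCommGroup V] [Module ℂ V] : Type _ :=
  ∀ i, Grass (d i) V

/-- The tangent model `∏ᵢ Hom(ℂ^(dᵢ), ℂ^(dim V - dᵢ))` of a product of Grassmannians. -/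
abbrev GrassProd.Model {ι : Type*} (d : ι → ℕ) (V : Type*) [AddCommGroup V] [Module ℂ V] :
    Type _ :=
  ∀ i, Grass.Model (d i) (Module.finrank ℂ V - d i)

/-- The (boundaryless, real) model of the manifold `∏ᵢ Gr(dᵢ, V)`. -/
abbrev grassI {ι : Type*} [Fintype ι] (d : ι → ℕ) (V : Type*) [AddCommGroup V] [Module ℂ V] :
    ModelWithCorners ℝ (GrassProd.Model d V)
      (ModelPi fun i ↦ Grass.Model (d i) (Module.finrank ℂ V - d i)) :=
  ModelWithCorners.pi fun i ↦ 𝓘(ℝ, Grass.Model (d i) (Module.finrank ℂ V - d i))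

instance {ι : Type*} [Fintype ι] (d : ι → ℕ) (V : Type*) [AddCommGroup V] [Module ℂ V]
    [FiniteDimensional ℂ V] : IsManifold (grassI d V) ∞ (GrassProd d V) := by
  apply isManifold_of_contDiffOn
  rintro _ _ ⟨e, he, rfl⟩ ⟨e', he', rfl⟩
  rw [contDiffOn_pi]
  intro i
  have h1 : (e i).symm ≫ₕ (e' i) ∈
      contDiffGroupoid ∞ 𝓘(ℝ, Grass.Model (d i) (Module.finrank ℂ V - d i)) :=
    (contDiffGroupoid ∞ _).compatible (he i trivial) (he' i trivial)
  rw [contDiffGroupoid, mem_groupoid_of_pregroupoid] at h1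
  have h2 := h1.1
  change ContDiffOn ℝ ∞ _ _ at h2
  refine h2.comp (contDiff_pi.mp contDiff_id i).contDiffOn ?_
  rintro A ⟨hA, -⟩
  have hA1 := hA
  refine ⟨?_, by simp⟩
  simp only [OpenPartialHomeomorph.trans_source] at hA1
  exact ⟨hA1.1 i trivial, hA1.2 i trivial⟩

/-! ### Submanifolds, smooth maps on subsets, tangent vectors, transversality -/

section Submanifold

variable {E : Type*} [NormedAddCommGroup E] [NormedSpace ℝ E] {H : Type*} [TopologicalSpace H]
  {M : Type*} [TopologicalSpace M] [ChartedSpace H M]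
  {E' : Type*} [NormedAddCommGroup E'] [NormedSpace ℝ E'] {H' : Type*} [TopologicalSpace H']
  {M' : Type*} [TopologicalSpace M'] [ChartedSpace H' M']

/-- A subset `S` of a (finite-dimensional, boundaryless) manifold is an embedded smooth submanifold
if around each of its points there is a smooth chart carrying `S` to a linear subspace. -/
def IsSubmanifold (I : ModelWithCorners ℝ E H) (S : Set M) : Prop :=
  ∀ p ∈ S, ∃ φ ∈ IsManifold.maximalAtlas I ∞ M, p ∈ φ.source ∧
    ∃ F : Submodule ℝ E, ∀ q ∈ φ.source, q ∈ S ↔ φ.extend I q ∈ F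

/-- The tangent vectors at `p` to a subset `S` of a manifold: velocities of smooth curves in `S`
through `p`. For a submanifold `S` this is its tangent space, as a subspace of that of `M`. -/
def tangentVectors (I : ModelWithCorners ℝ E H) (S : Set M) (p : M) : Set (TangentSpace I p) :=
  {v | ∃ (γ : ℝ → M) (ε : ℝ), 0 < ε ∧ ContMDiffOn 𝓘(ℝ, ℝ) I ∞ γ (Set.Ioo (-ε) ε) ∧
    (∀ t ∈ Set.Ioo (-ε) ε, γ t ∈ S) ∧ γ 0 = p ∧
    (mfderiv 𝓘(ℝ, ℝ) I γ 0 (1 : ℝ) : E) = v}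

/-- Submanifolds `S, T ⊆ Y` of `M` meet transversely in the submanifold `Y` if
`T_p S + T_p T = T_p Y` at every `p ∈ S ∩ T`. -/
def MeetTransversely (I : ModelWithCorners ℝ E H) (Y S T : Set M) : Prop :=
  ∀ p ∈ S ∩ T, ∀ v ∈ tangentVectors I Y p,
    ∃ u ∈ tangentVectors I S p, ∃ w ∈ tangentVectors I T p, u + w = v

/-- Let `ι : X → M` be an injection onto a submanifold, through which `X` is regarded as a
manifold. A bijection `Φ` from `X` onto a manifold `M'` is a diffeomorphism: `Φ` is
smooth, i.e. extends locally to a smooth map on an open subset of `M`, and its inverse is smooth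
as a map to `M`. -/
def IsDiffeoOfSubmanifold (I : ModelWithCorners ℝ E H) (I' : ModelWithCorners ℝ E' H')
    {X : Type*} (ι : X → M) (Φ : X ≃ M') : Prop :=
  (∀ x : X, ∃ U : Set M, IsOpen U ∧ ι x ∈ U ∧ ∃ F : M → M', ContMDiffOn I I' ∞ F U ∧
    ∀ y : X, ι y ∈ U → F (ι y) = Φ y) ∧
  ContMDiff I' I ∞ (fun q : M' ↦ ι (Φ.symm q))

end Submanifold

/-! ### The space `ℂ^m ⊗ z⁻¹ℂ[z⁻¹]` -/

/-- `E ⊗ z⁻¹ℂ[z⁻¹]`: the value of an element at `k` is its coefficient of `z^(-(k+1))`. -/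
abbrev Tails (E : Type*) [AddCommGroup E] : Type _ := ℕ →₀ E

/-- Multiplication by `z` on `E ⊗ z⁻¹ℂ[z⁻¹] = E ⊗ (ℂ((z))/ℂ[[z]])`. -/
def zMul (E : Type*) [AddCommGroup E] [Module ℂ E] : Tails E →ₗ[ℂ] Tails E :=
  Finsupp.lcomapDomain Nat.succ Nat.succ_injective

@[simp] theorem zMul_apply {E : Type*} [AddCommGroup E] [Module ℂ E] (v : Tails E) (k : ℕ) :
    zMul E v k = v (k + 1) := rfl

/-- The map `C : E ⊗ z⁻¹ℂ[z⁻¹] → E`, `∑ v_k z^(-k) ↦ ∑ v_k`; that is, the evaluation at `z = 1`,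
or the residue at `z = 0` of `v(z) dz / (1 - z)`. -/
def residueMap (E : Type*) [AddCommGroup E] [Module ℂ E] : Tails E →ₗ[ℂ] E :=
  Finsupp.lsum ℂ fun _ ↦ LinearMap.id

/-- `E ⊗ span(z⁻¹, …, z⁻ⁿ)`. -/
abbrev TruncTails (E : Type*) [AddCommGroup E] [Module ℂ E] (n : ℕ) : Submodule ℂ (Tails E) :=
  Finsupp.supported E ℂ (Set.Iio n)

instance {E : Type*} [AddCommGroup E] [Module ℂ E] [FiniteDimensional ℂ E] (n : ℕ) :
    FiniteDimensional ℂ (TruncTails E n) :=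
  (Finsupp.supportedEquivFinsupp (M := E) (R := ℂ) (Set.Iio n)).symm.finiteDimensional

/-- The Hermitian inner product `⟨v ⊗ z^k, w ⊗ z^l⟩ = δ_{k,l} ⟨v, w⟩` on `E ⊗ z⁻¹ℂ[z⁻¹]`. -/
def tailInner {E : Type*} [NormedAddCommGroup E] [InnerProductSpace ℂ E] (v w : Tails E) : ℂ :=
  v.sum fun k x ↦ inner ℂ x (w k)

/-- `L ∩ L'^⊥`, the orthogonal complement of `L'` in `L`. -/
def perpIn {E : Type*} [NormedAddCommGroup E] [InnerProductSpace ℂ E]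
    (L' L : Submodule ℂ (Tails E)) : Submodule ℂ (Tails E) where
  carrier := {w | w ∈ L ∧ ∀ u ∈ L', tailInner u w = 0}
  zero_mem' := ⟨L.zero_mem, fun u _ ↦ by simp [tailInner]⟩
  add_mem' := by
    rintro a b ⟨ha, ha'⟩ ⟨hb, hb'⟩
    refine ⟨L.add_mem ha hb, fun u hu ↦ ?_⟩
    have h1 := ha' u hu
    have h2 := hb' u hu
    simp only [tailInner] at h1 h2 ⊢
    simp only [Finsupp.add_apply, inner_add_right, Finsupp.sum_add, h1, h2, add_zero]
  smul_mem' := by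
    rintro c a ⟨ha, ha'⟩
    refine ⟨L.smul_mem c ha, fun u hu ↦ ?_⟩
    have h1 := ha' u hu
    simp only [tailInner] at h1 ⊢
    simp only [Finsupp.smul_apply, inner_smul_right, Finsupp.sum, ← Finset.mul_sum] at h1 ⊢
    rw [h1, mul_zero]

/-! ### The varieties `Y_β` and `X_β^i` -/

/-- A point of `Y_β`: a chain `0 = L₀ ⊆ L₁ ⊆ ⋯ ⊆ Lₙ` of subspaces of `E ⊗ z⁻¹ℂ[z⁻¹]` with
`dim (Lₖ₊₁ / Lₖ) = βₖ` and `z Lₖ₊₁ ⊆ Lₖ`. The entries of `β` are indexed from `0`. -/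
structure YVar (E : Type*) [AddCommGroup E] [Module ℂ E] {n : ℕ} (β : Fin n → ℕ) where
  L : Fin (n + 1) → Submodule ℂ (Tails E)
  zero_eq : L 0 = ⊥
  le_succ : ∀ k : Fin n, L k.castSucc ≤ L k.succ
  finrank_quot : ∀ k : Fin n,
    Module.finrank ℂ (↥(L k.succ) ⧸ (L k.castSucc).submoduleOf (L k.succ)) = β k
  map_z_le : ∀ k : Fin n, (L k.succ).map (zMul E) ≤ L k.castSucc

namespace YVar

variable {E : Type*} [AddCommGroup E] [Module ℂ E] {n : ℕ} {β : Fin n → ℕ}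

theorem le_trunc (y : YVar E β) (k : Fin (n + 1)) : y.L k ≤ TruncTails E k := by
  induction k using Fin.induction with
  | zero => rw [y.zero_eq]; exact bot_le
  | succ k ih =>
    intro v hv
    rw [Finsupp.mem_supported']
    intro j hj
    simp only [Set.mem_Iio, not_lt, Fin.val_succ] at hj
    obtain ⟨j, rfl⟩ : ∃ i, j = i + 1 := ⟨j - 1, by omega⟩
    have h1 := ih (y.map_z_le k (Submodule.mem_map_of_mem hv))
    rw [Finsupp.mem_supported'] at h1
    exact h1 j (by simp only [Set.mem_Iio, Fin.val_castSucc, not_lt]; omega)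

theorem le_trunc_top (y : YVar E β) (k : Fin (n + 1)) : y.L k ≤ TruncTails E n :=
  (y.le_trunc k).trans (Finsupp.supported_mono (Set.Iio_subset_Iio (Nat.lt_succ_iff.1 k.2)))

theorem finrank_L [FiniteDimensional ℂ E] (y : YVar E β) (k : Fin (n + 1)) :
    Module.finrank ℂ (y.L k) = Fin.partialSum β k := by
  have hfin : ∀ k, FiniteDimensional ℂ (y.L k) := fun k ↦
    Submodule.finiteDimensional_of_le (y.le_trunc_top k)
  induction k using Fin.induction with
  | zero => rw [y.zero_eq]; simp
  | succ k ih =>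
    have h1 := Submodule.finrank_quotient_add_finrank
      ((y.L k.castSucc).submoduleOf (y.L k.succ))
    rw [y.finrank_quot, (Submodule.submoduleOfEquivOfLe (y.le_succ k)).finrank_eq, ih] at h1
    rw [Fin.partialSum_succ]
    omega

/-- The realization of `Y_β` as a subset of a product of Grassmannians:
`(L₁, …, Lₙ) ↦ (L₁, …, Lₙ)`, where `Lₖ` is a subspace of `E ⊗ span(z⁻¹, …, z⁻ⁿ)` of dimension
`β₁ + ⋯ + βₖ`. It gives `Y_β` its manifold structure. -/
def toGrass [FiniteDimensional ℂ E] (y : YVar E β) :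
    GrassProd (fun k : Fin n ↦ Fin.partialSum β k.succ) (TruncTails E n) := fun k ↦
  { carrier := (y.L k.succ).submoduleOf (TruncTails E n)
    finrank_eq := by
      rw [(Submodule.submoduleOfEquivOfLe (y.le_trunc_top k.succ)).finrank_eq, y.finrank_L] }

theorem toGrass_injective [FiniteDimensional ℂ E] :
    Function.Injective (toGrass : YVar E β → _) := by
  intro x y h
  have hL : x.L = y.L := by
    funext k
    refine Fin.cases (by rw [x.zero_eq, y.zero_eq]) (fun k ↦ ?_) k
    have h1 : (x.L k.succ).submoduleOf (TruncTails E n) = (y.L k.succ).submoduleOf (TruncTails E n) :=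
      congrArg Grass.carrier (congrFun h k)
    have h2 := congrArg (Submodule.map (TruncTails E n).subtype) h1
    simpa only [Submodule.submoduleOf, Submodule.map_comap_subtype,
      inf_eq_right.2 (x.le_trunc_top _), inf_eq_right.2 (y.le_trunc_top _)] using h2
  cases x; cases y; cases hL; rfl

end YVar

/-- `X_β^i ⊆ Y_β` for the consecutive entries `β i`, `β (i+1)` (indexed from `0`), `m = dim E`.
With `L' = L i`, `L'' = L (i+2)` the terms of the chain before and after these two steps:
`z L'' ⊆ L'` if `β i + β (i+1) ≤ m`; otherwise `L' ⊆ z L''` and `ker z ⊆ L''`. (The two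
conditions agree if `β i + β (i+1) = m`.) -/
def XVar (E : Type*) [AddCommGroup E] [Module ℂ E] {n : ℕ} (β : Fin n → ℕ) (i : ℕ)
    (hi : i + 1 < n) : Set (YVar E β) :=
  {y | if β ⟨i, by omega⟩ + β ⟨i + 1, hi⟩ ≤ Module.finrank ℂ E then
      (y.L ⟨i + 2, by omega⟩).map (zMul E) ≤ y.L ⟨i, by omega⟩
    else
      y.L ⟨i, by omega⟩ ≤ (y.L ⟨i + 2, by omega⟩).map (zMul E) ∧
        LinearMap.ker (zMul E) ≤ y.L ⟨i + 2, by omega⟩}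

/-- `A_β^i`: the tuples `(l_k)` of subspaces of `E` such that `l_i` and `l_{i+1}` are perpendicular.
For dimensions adding up to at most `m = dim E` this means `l_i ⟂ l_{i+1}`; for two subspaces whose
dimensions add up to more it means, as for planes in space, that their orthogonal
complements are perpendicular: `l_i^⊥ ⟂ l_{i+1}^⊥`. (The two conditions agree if the dimensions
add up to `m`.) -/
def AVar (E : Type*) [NormedAddCommGroup E] [InnerProductSpace ℂ E] {n : ℕ} (β : Fin n → ℕ)
    (i : ℕ) (hi : i + 1 < n) : Set (GrassProd β E) :=
  {l | if β ⟨i, by omega⟩ + β ⟨i + 1, hi⟩ ≤ Module.finrank ℂ E then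
      (l ⟨i, by omega⟩).carrier ⟂ (l ⟨i + 1, hi⟩).carrier
    else
      (l ⟨i, by omega⟩).carrierᗮ ⟂ (l ⟨i + 1, hi⟩).carrierᗮ}

end

noncomputable section

open scoped Topology

section TailsGeometry

variable {E : Type*} [NormedAddCommGroup E] [InnerProductSpace ℂ E]

/-! ### The inner product space `E ⊗ z⁻¹ℂ[z⁻¹]` -/

/-! Write `z⁻¹L` for the preimage of `L` under `z`. Everything rests on one fact: if `zL ⊆ L` and
`L` lies in some `span(z⁻¹, …, z⁻ᵏ)`, then `C` restricts to a unitary isomorphism `z⁻¹L ∩ L^⊥ → E`.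
Indeed `⟨Cv, Cw⟩` is the sum of all `⟨v_i, w_j⟩`, which is `⟨v, w⟩ + ⟨(z + z² + ⋯)v, w⟩ + ⟨v, (z +
z² + ⋯)w⟩` (`inner_residueMap`). For `v, w` in `z⁻¹L ∩ L^⊥` the series sends both into `L`, so the
cross terms vanish (`inner_residueMap_zPerp`). Surjectivity comes from the explicit inverse
`residueInv`, written with the orthogonal projection onto `L`; that form also yields smoothness.

In a chain, `L_k` is the orthogonal sum of `L_{k-1}` and a piece of dimension `β_k`, which may be
any such subspace of `z⁻¹L_{k-1} ∩ L_{k-1}^⊥`. Given `L_{k-1}`, choosing `L_k` is therefore choosing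
a point of `Gr(β_k, E)`, and `Φ` is bijective by recursion on `k`.

For `v`, `w` in two consecutive pieces the formula reduces to `⟨Cv, Cw⟩ = ⟨v, zw⟩`
(`inner_residueMap_perpIn`), so `l_i ⟂ l_{i+1}` says `zL_{i+1} ⊆ L_{i-1}`. In the other case, `l_i^⊥
⊆ l_{i+1}` says `z⁻¹L_{i-1} ⊆ L_{i+1}` (`comap_zMul_le_iff_isOrtho`).

Smoothness is handled through projections: the orthogonal projection depends smoothly on the
subspace (`Grass.contMDiff_starProjection`), and a smooth family of operators has, locally, smooth
families of subspaces in its ranges (`Grass.exists_contMDiffOn_le_range`). The components of `Φ` and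
of `Φ⁻¹` are ranges of operators built from projections.

Submanifolds are obtained as smooth local retracts (`isSubmanifold_of_retract`). The retraction onto
`A_β^i` moves `l_{i+1}` only (`exists_retract_AVar`). This also gives transversality: for `i < j`, a
velocity differs from its image under the retraction onto `A_β^j` only in the factor of `l_{j+1}`,
on which `A_β^i` imposes no condition (`exists_curves_AVar`). The statement is then carried to `Y_β`
by `Φ⁻¹`. -/

theorem tailInner_eq_sum (v w : Tails E) (s : Finset ℕ) (hs : v.support ⊆ s) :
    tailInner v w = ∑ k ∈ s, inner ℂ (v k) (w k) :=
  Finsupp.sum_of_support_subset _ hs _ fun _ _ ↦ inner_zero_left _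

/-- `tailInner` is an inner product. -/
@[reducible] def tailsCore : InnerProductSpace.Core ℂ (Tails E) where
  inner := tailInner
  conj_inner_symm v w := by
    classical
    rw [tailInner_eq_sum w v (v.support ∪ w.support) Finset.subset_union_right,
      tailInner_eq_sum v w (v.support ∪ w.support) Finset.subset_union_left, map_sum]
    exact Finset.sum_congr rfl fun k _ ↦ inner_conj_symm _ _
  re_inner_nonneg v := by
    rw [tailInner, Finsupp.sum, map_sum]
    exact Finset.sum_nonneg fun k _ ↦ inner_self_nonneg
  add_left u v w := by
    classical
    rw [tailInner, Finsupp.sum_add_index' (by simp) (fun _ _ _ ↦ inner_add_left _ _ _)]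
    rfl
  smul_left v w c := by
    rw [tailInner, Finsupp.sum_smul_index' (by simp), tailInner, Finsupp.sum, Finsupp.sum,
      Finset.mul_sum]
    exact Finset.sum_congr rfl fun _ _ ↦ inner_smul_left _ _ _
  definite v h := by
    rw [tailInner, Finsupp.sum] at h
    have h2 := congrArg RCLike.re h
    rw [map_sum, map_zero, Finset.sum_eq_zero_iff_of_nonneg (fun k _ ↦ inner_self_nonneg)] at h2
    ext k
    by_cases hk : k ∈ v.support
    · have h3 := h2 k hk
      rw [inner_self_eq_norm_sq (𝕜 := ℂ)] at h3
      simpa using h3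
    · simpa using hk

/-- The norm on `E ⊗ z⁻¹ℂ[z⁻¹]` attached to `tailInner`. -/
@[reducible] def tailsNormedAddCommGroup : NormedAddCommGroup (Tails E) :=
  (tailsCore (E := E)).toNormedAddCommGroup

attribute [local instance] tailsNormedAddCommGroup

/-- The inner product space structure on `E ⊗ z⁻¹ℂ[z⁻¹]` given by `tailInner`. -/
@[reducible] def tailsInnerProductSpace : InnerProductSpace ℂ (Tails E) :=
  InnerProductSpace.ofCore tailsCore.toCore

attribute [local instance] tailsInnerProductSpace

theorem tails_inner_def (v w : Tails E) : inner ℂ v w = tailInner v w := rfl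

theorem perpIn_eq (L' L : Submodule ℂ (Tails E)) : perpIn L' L = L ⊓ L'ᗮ := rfl

@[simp] theorem tails_inner_single_left (k : ℕ) (x : E) (w : Tails E) :
    inner ℂ (Finsupp.single k x) w = inner ℂ x (w k) := by
  rw [tails_inner_def, tailInner]
  exact Finsupp.sum_single_index (inner_zero_left _)

/-! ### Multiplication by `z`, its adjoint, and the map `C` -/

@[simp] theorem zMul_single_zero (x : E) : zMul E (Finsupp.single 0 x) = 0 := by
  ext k; simp

@[simp] theorem zMul_single_succ (k : ℕ) (x : E) :
    zMul E (Finsupp.single (k + 1) x) = Finsupp.single k x := by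
  ext j; simp [Finsupp.single_apply]

@[simp] theorem residueMap_single (k : ℕ) (x : E) :
    residueMap E (Finsupp.single k x) = x := by
  simp [residueMap]

variable (E) in
/-- Multiplication by `z⁻¹`. -/
def zInv : Tails E →ₗ[ℂ] Tails E := Finsupp.lmapDomain E ℂ Nat.succ

@[simp] theorem zInv_single (k : ℕ) (x : E) :
    zInv E (Finsupp.single k x) = Finsupp.single (k + 1) x := by
  simp [zInv]

@[simp] theorem zMul_zInv (v : Tails E) : zMul E (zInv E v) = v := by
  induction v using Finsupp.induction_linear with
  | zero => simp
  | add f g hf hg => rw [map_add, map_add, hf, hg]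
  | single k x => simp

@[simp] theorem residueMap_zInv (v : Tails E) : residueMap E (zInv E v) = residueMap E v := by
  induction v using Finsupp.induction_linear with
  | zero => simp
  | add f g hf hg => rw [map_add, map_add, map_add, hf, hg]
  | single k x => simp

/-- As the adjoint of `z`, multiplication by `z⁻¹` preserves `L^⊥` whenever `zL ⊆ L`. -/
theorem inner_zInv_right (u v : Tails E) : inner ℂ u (zInv E v) = inner ℂ (zMul E u) v := by
  induction v using Finsupp.induction_linear with
  | zero => simp
  | add f g hf hg => rw [map_add, inner_add_right, inner_add_right, hf, hg]
  | single k x =>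
    rw [zInv_single, ← inner_conj_symm, ← inner_conj_symm (zMul E u)]
    simp

variable (E) in
/-- The operator `z + z² + ⋯`. -/
def zGeom : Tails E →ₗ[ℂ] Tails E :=
  Finsupp.lsum ℂ fun i ↦ ∑ j ∈ Finset.range i, Finsupp.lsingle j

theorem zGeom_single (i : ℕ) (x : E) :
    zGeom E (Finsupp.single i x) = ∑ j ∈ Finset.range i, Finsupp.single j x := by
  simp [zGeom]

/-- The recursion of the geometric series; it permits induction on the pole order, which `z` lowers.
-/
theorem zGeom_eq (v : Tails E) : zGeom E v = zMul E v + zGeom E (zMul E v) := by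
  induction v using Finsupp.induction_linear with
  | zero => simp
  | add f g hf hg => simp only [map_add]; rw [hf, hg]; abel
  | single k x =>
    cases k with
    | zero => simp [zGeom_single]
    | succ k => simp [zGeom_single, Finset.sum_range_succ, add_comm]

theorem inner_zGeom_single (i j : ℕ) (x y : E) :
    inner ℂ (zGeom E (Finsupp.single i x)) (Finsupp.single j y) =
      if j < i then inner ℂ x y else 0 := by
  rw [zGeom_single, sum_inner]
  simp only [tails_inner_single_left, Finsupp.single_apply, apply_ite (inner ℂ x),
    inner_zero_right, Finset.sum_ite_eq, Finset.mem_range]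

/-- The relation between the inner products of `v, w` and of `C v, C w`. -/
theorem inner_residueMap (v w : Tails E) :
    inner ℂ (residueMap E v) (residueMap E w) =
      inner ℂ v w + inner ℂ (zGeom E v) w + inner ℂ v (zGeom E w) := by
  induction v using Finsupp.induction_linear with
  | zero => simp
  | add f g hf hg => simp only [map_add, inner_add_left]; rw [hf, hg]; ring
  | single i x =>
    induction w using Finsupp.induction_linear with
    | zero => simp
    | add f g hf hg => simp only [map_add, inner_add_right]; rw [hf, hg]; ring
    | single j y =>
      rw [← inner_conj_symm (Finsupp.single i x) (zGeom E _), inner_zGeom_single,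
        inner_zGeom_single, residueMap_single, residueMap_single, tails_inner_single_left,
        Finsupp.single_apply]
      rcases lt_trichotomy i j with h | h | h
      · simp [h, h.ne', h.not_gt]
      · simp [h]
      · simp [h, h.ne, h.not_gt]

theorem exists_mem_truncTails (v : Tails E) : ∃ N, v ∈ TruncTails E N := by
  refine ⟨v.support.sup id + 1, fun k hk ↦ ?_⟩
  simpa [Nat.lt_succ_iff] using Finset.le_sup (f := id) hk

theorem zMul_mem_truncTails {v : Tails E} {N : ℕ} (h : v ∈ TruncTails E (N + 1)) :
    zMul E v ∈ TruncTails E N := by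
  rw [Finsupp.mem_supported'] at h ⊢
  intro k hk
  exact h (k + 1) (by simpa using hk)

theorem le_truncTails_succ {L : Submodule ℂ (Tails E)} {k : ℕ}
    (h : L.map (zMul E) ≤ TruncTails E k) : L ≤ TruncTails E (k + 1) := by
  intro v hv
  have h1 := h (Submodule.mem_map_of_mem hv)
  rw [Finsupp.mem_supported'] at h1 ⊢
  rintro (_ | j) hj
  · simp at hj
  · exact h1 j (by simpa using hj)

/-- Only finitely many `zʲv` are nonzero, and all of them with `j ≥ 1` lie in `L`. -/
theorem zGeom_mem {L : Submodule ℂ (Tails E)} (hL : L.map (zMul E) ≤ L) {v : Tails E}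
    (hv : zMul E v ∈ L) : zGeom E v ∈ L := by
  have key : ∀ (N : ℕ) (u : Tails E), u ∈ TruncTails E N → u ∈ L → zGeom E u ∈ L := by
    intro N
    induction N with
    | zero =>
      intro u hu _
      have : u = 0 := by
        ext k
        rw [Finsupp.mem_supported'] at hu
        simpa using hu k (by simp)
      simp [this]
    | succ N ih =>
      intro u hu hu'
      have h1 := hL (Submodule.mem_map_of_mem hu')
      rw [zGeom_eq]
      exact L.add_mem h1 (ih _ (zMul_mem_truncTails hu) h1)
  obtain ⟨N, hN⟩ := exists_mem_truncTails (zMul E v)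
  rw [zGeom_eq]
  exact L.add_mem hv (key N _ hN hv)

/-! ### The isometry `C : z⁻¹L ∩ L^⊥ → E` -/

/-- `z⁻¹L ∩ L^⊥`. -/
def zPerp (L : Submodule ℂ (Tails E)) : Submodule ℂ (Tails E) := L.comap (zMul E) ⊓ Lᗮ

/-- The cross terms pair an element of `L` with one of `L^⊥`. -/
theorem inner_residueMap_zPerp {L : Submodule ℂ (Tails E)} (hL : L.map (zMul E) ≤ L)
    {v w : Tails E} (hv : v ∈ zPerp L) (hw : w ∈ zPerp L) :
    inner ℂ (residueMap E v) (residueMap E w) = inner ℂ v w := by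
  rw [inner_residueMap, Submodule.inner_right_of_mem_orthogonal (zGeom_mem hL hv.1) hw.2,
    Submodule.inner_left_of_mem_orthogonal (zGeom_mem hL hw.1) hv.2, add_zero, add_zero]

theorem residueMap_injOn_zPerp {L : Submodule ℂ (Tails E)} (hL : L.map (zMul E) ≤ L) :
    Set.InjOn (residueMap E) (zPerp L) := by
  intro v hv w hw h
  rw [← sub_eq_zero, ← inner_self_eq_zero (𝕜 := ℂ),
    ← inner_residueMap_zPerp hL (sub_mem hv hw) (sub_mem hv hw), map_sub, h, sub_self,
    inner_zero_left]

variable (E) in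
/-- `x ↦ x ⊗ (z⁻¹ + ⋯ + z^(-(k+1)))`. -/
def constTail (k : ℕ) : E →ₗ[ℂ] Tails E := ∑ i ∈ Finset.range (k + 1), Finsupp.lsingle i

theorem constTail_apply (k : ℕ) (x : E) :
    constTail E k x = ∑ i ∈ Finset.range (k + 1), Finsupp.single i x := by
  simp [constTail]

/-- The sum telescopes to its lowest power `z^(-(k+1))`, which is orthogonal to any `L ⊆ span(z⁻¹,
…, z⁻ᵏ)`. -/
theorem constTail_sub_zMul (k : ℕ) (x : E) :
    constTail E k x - zMul E (constTail E k x) = Finsupp.single k x := by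
  rw [constTail_apply, map_sum, Finset.sum_range_succ, Finset.sum_range_succ' (fun i ↦ zMul E _)]
  simp

theorem single_mem_orthogonal {L : Submodule ℂ (Tails E)} {k : ℕ} (hL : L ≤ TruncTails E k)
    (x : E) : Finsupp.single k x ∈ Lᗮ := by
  rw [Submodule.mem_orthogonal']
  intro u hu
  have h := hL hu
  rw [Finsupp.mem_supported'] at h
  rw [tails_inner_single_left, h k (by simp), inner_zero_right]

/-- The inverse of the isometry `C : z⁻¹L ∩ L^⊥ → E`, for `L ⊆ span(z⁻¹, …, z⁻ᵏ)`. -/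
def residueInv (L : Submodule ℂ (Tails E)) [L.HasOrthogonalProjection] (k : ℕ) (x : E) : Tails E :=
  (constTail E k x - L.starProjection (constTail E k x)) -
    zInv E (zMul E (constTail E k x) - L.starProjection (zMul E (constTail E k x)))

/-- With `c = constTail E k x` and `P` the projection onto `L`, the vector is `(1 - P)c - z⁻¹(1 -
P)zc`. Applying `z` cancels `zc` and leaves `Pzc - zPc ∈ L`; both summands lie in `L^⊥` because
`z⁻¹` is adjoint to `z`. -/
theorem residueInv_mem {L : Submodule ℂ (Tails E)} [L.HasOrthogonalProjection]
    (hL : L.map (zMul E) ≤ L) (k : ℕ) (x : E) : residueInv L k x ∈ zPerp L := by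
  constructor
  · change zMul E (residueInv L k x) ∈ L
    have h : zMul E (residueInv L k x) = L.starProjection (zMul E (constTail E k x)) -
        zMul E (L.starProjection (constTail E k x)) := by
      rw [residueInv, map_sub, zMul_zInv, map_sub]; abel
    rw [h]
    exact sub_mem (Submodule.starProjection_apply_mem _ _)
      (hL (Submodule.mem_map_of_mem (Submodule.starProjection_apply_mem _ _)))
  · refine sub_mem (Submodule.sub_starProjection_mem_orthogonal _) ?_
    intro u hu
    rw [inner_zInv_right]
    exact Submodule.sub_starProjection_mem_orthogonal _ _ (hL (Submodule.mem_map_of_mem hu))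

/-- Since `C` does not see the factor `z⁻¹`, the two terms combine to `C((1 - P)(c - zc))`, and `c -
zc = x ⊗ z^(-(k+1))` is killed by `P`. -/
theorem residueMap_residueInv {L : Submodule ℂ (Tails E)} [L.HasOrthogonalProjection]
    {k : ℕ} (hL : L ≤ TruncTails E k) (x : E) : residueMap E (residueInv L k x) = x := by
  have h : residueMap E (residueInv L k x) =
      residueMap E ((constTail E k x - zMul E (constTail E k x)) -
        L.starProjection (constTail E k x - zMul E (constTail E k x))) := by
    rw [residueInv, map_sub, residueMap_zInv, ← map_sub, map_sub L.starProjection]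
    congr 1; abel
  rw [h, constTail_sub_zMul, L.starProjection_apply_eq_zero_iff.2 (single_mem_orthogonal hL x),
    sub_zero, residueMap_single]

/-! ### Adding one step to a chain -/

/-- The subspace of `z⁻¹L ∩ L^⊥` corresponding to `q ⊆ E` under the isometry `C`. -/
def chainStep (L : Submodule ℂ (Tails E)) (q : Submodule ℂ E) : Submodule ℂ (Tails E) :=
  zPerp L ⊓ q.comap (residueMap E)

theorem chainStep_le_zPerp (L : Submodule ℂ (Tails E)) (q : Submodule ℂ E) :
    chainStep L q ≤ zPerp L := inf_le_left

theorem chainStep_map {L : Submodule ℂ (Tails E)} (hL : L.map (zMul E) ≤ L)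
    {U : Submodule ℂ (Tails E)} (hU : U ≤ zPerp L) : chainStep L (U.map (residueMap E)) = U := by
  refine le_antisymm ?_ (le_inf hU (Submodule.le_comap_map _ _))
  rintro v ⟨hv, u, hu, huv⟩
  rwa [← residueMap_injOn_zPerp hL (hU hu) hv huv]

theorem map_chainStep {L : Submodule ℂ (Tails E)} [L.HasOrthogonalProjection]
    (hL : L.map (zMul E) ≤ L) {k : ℕ} (hk : L ≤ TruncTails E k) (q : Submodule ℂ E) :
    (chainStep L q).map (residueMap E) = q := by
  refine le_antisymm (Submodule.map_le_iff_le_comap.2 inf_le_right) fun x hx ↦ ?_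
  exact ⟨residueInv L k x, ⟨residueInv_mem hL k x, by
    change residueMap E _ ∈ q; rwa [residueMap_residueInv hk]⟩, residueMap_residueInv hk x⟩

theorem mem_chainStep_iff {L : Submodule ℂ (Tails E)} [L.HasOrthogonalProjection]
    (hL : L.map (zMul E) ≤ L) {k : ℕ} (hk : L ≤ TruncTails E k) (q : Submodule ℂ E)
    (v : Tails E) : v ∈ chainStep L q ↔ ∃ x ∈ q, residueInv L k x = v := by
  constructor
  · rintro ⟨hv, hv'⟩
    exact ⟨_, hv', residueMap_injOn_zPerp hL (residueInv_mem hL k _) hv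
      (residueMap_residueInv hk _)⟩
  · rintro ⟨x, hx, rfl⟩
    exact ⟨residueInv_mem hL k x, by change residueMap E _ ∈ q; rwa [residueMap_residueInv hk]⟩

theorem finrank_map_residueMap {L : Submodule ℂ (Tails E)} (hL : L.map (zMul E) ≤ L)
    {U : Submodule ℂ (Tails E)} (hU : U ≤ zPerp L) :
    Module.finrank ℂ (U.map (residueMap E)) = Module.finrank ℂ U := by
  rw [← LinearMap.range_domRestrict]
  apply LinearMap.finrank_range_of_inj
  intro v w h
  exact Subtype.ext (residueMap_injOn_zPerp hL (hU v.2) (hU w.2) h)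

theorem perpIn_le_right (L' L : Submodule ℂ (Tails E)) : perpIn L' L ≤ L := fun _ hv ↦ hv.1

theorem perpIn_le_zPerp {L' L : Submodule ℂ (Tails E)} (h : L.map (zMul E) ≤ L') :
    perpIn L' L ≤ zPerp L' :=
  fun _ hv ↦ ⟨h (Submodule.mem_map_of_mem hv.1), hv.2⟩

theorem sup_perpIn {L' L : Submodule ℂ (Tails E)} [L'.HasOrthogonalProjection] (h : L' ≤ L) :
    L' ⊔ perpIn L' L = L := by
  rw [perpIn_eq, inf_comm]
  exact Submodule.sup_orthogonal_inf_of_hasOrthogonalProjection h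

theorem perpIn_sup {L U : Submodule ℂ (Tails E)} (h : U ≤ Lᗮ) : perpIn L (L ⊔ U) = U := by
  rw [perpIn_eq, sup_comm, sup_inf_assoc_of_le L h, Submodule.inf_orthogonal_eq_bot, sup_bot_eq]

theorem zPerp_le_orthogonal (L : Submodule ℂ (Tails E)) : zPerp L ≤ Lᗮ := inf_le_right

theorem finrank_quotient_eq_finrank_perpIn {L' L : Submodule ℂ (Tails E)} [FiniteDimensional ℂ L]
    (h : L' ≤ L) : Module.finrank ℂ (↥L ⧸ L'.submoduleOf L) = Module.finrank ℂ (perpIn L' L) := by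
  have : FiniteDimensional ℂ L' := Submodule.finiteDimensional_of_le h
  have h1 := Submodule.finrank_quotient_add_finrank (L'.submoduleOf L)
  have h2 := Submodule.finrank_add_inf_finrank_orthogonal h
  rw [(Submodule.submoduleOfEquivOfLe h).finrank_eq] at h1
  rw [perpIn_eq, inf_comm]
  omega

/-! ### Perpendicularity -/

section Perpendicular

variable {L₀ L₁ L₂ : Submodule ℂ (Tails E)}

/-- In `inner_residueMap` only the first term of the series applied to `w` survives: `w ⟂ L₁`
removes the terms with `w` itself, and `z²w, z³w, …` lie in `L₀`, which is orthogonal to `v`. -/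
theorem inner_residueMap_perpIn (h01 : L₀ ≤ L₁) (hz1 : L₁.map (zMul E) ≤ L₀)
    (hz2 : L₂.map (zMul E) ≤ L₁) {v w : Tails E} (hv : v ∈ perpIn L₀ L₁) (hw : w ∈ perpIn L₁ L₂) :
    inner ℂ (residueMap E v) (residueMap E w) = inner ℂ v (zMul E w) := by
  have hz0 : L₀.map (zMul E) ≤ L₀ := (Submodule.map_mono h01).trans hz1
  have hzw : zMul E w ∈ L₁ := hz2 (Submodule.mem_map_of_mem hw.1)
  have h1 : zGeom E v ∈ L₁ :=
    h01 (zGeom_mem hz0 (hz1 (Submodule.mem_map_of_mem hv.1)))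
  have h2 : zGeom E (zMul E w) ∈ L₀ := zGeom_mem hz0 (hz1 (Submodule.mem_map_of_mem hzw))
  rw [inner_residueMap, zGeom_eq w, inner_add_right,
    Submodule.inner_right_of_mem_orthogonal (K := L₁) hv.1 hw.2,
    Submodule.inner_right_of_mem_orthogonal (K := L₁) h1 hw.2,
    Submodule.inner_left_of_mem_orthogonal (K := L₀) h2 hv.2]
  simp

theorem map_zMul_le_iff_isOrtho [L₀.HasOrthogonalProjection] [L₁.HasOrthogonalProjection]
    (h01 : L₀ ≤ L₁) (h12 : L₁ ≤ L₂) (hz1 : L₁.map (zMul E) ≤ L₀) (hz2 : L₂.map (zMul E) ≤ L₁) :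
    L₂.map (zMul E) ≤ L₀ ↔
      (perpIn L₀ L₁).map (residueMap E) ⟂ (perpIn L₁ L₂).map (residueMap E) := by
  rw [Submodule.isOrtho_iff_inner_eq]
  constructor
  · rintro h _ ⟨v, hv, rfl⟩ _ ⟨w, hw, rfl⟩
    rw [inner_residueMap_perpIn h01 hz1 hz2 hv hw]
    exact Submodule.inner_left_of_mem_orthogonal (h (Submodule.mem_map_of_mem hw.1)) hv.2
  · intro h
    rw [← sup_perpIn h12, Submodule.map_sup, sup_le_iff]
    refine ⟨hz1, ?_⟩
    rintro _ ⟨w, hw, rfl⟩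
    -- Split `zw ∈ L₁` along `L₀` and its complement in `L₁`. Testing the hypothesis against the
    -- complementary component `y` gives `⟨y, y⟩ = 0`.
    have hzw : zMul E w ∈ L₀ ⊔ perpIn L₀ L₁ := by
      rw [sup_perpIn h01]; exact hz2 (Submodule.mem_map_of_mem hw.1)
    obtain ⟨x, hx, y, hy, hxy⟩ := Submodule.mem_sup.1 hzw
    have h1 := h _ (Submodule.mem_map_of_mem hy) _ (Submodule.mem_map_of_mem hw)
    rw [inner_residueMap_perpIn h01 hz1 hz2 hy hw, ← hxy, inner_add_right,
      Submodule.inner_left_of_mem_orthogonal hx hy.2, zero_add, inner_self_eq_zero] at h1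
    rw [← hxy, h1, add_zero]
    exact hx

/-- As `z` is surjective, the two conditions of the second case in `XVar` amount to the single
inclusion `z⁻¹L₀ ⊆ L₂`. -/
theorem comap_zMul_le_iff : L₀.comap (zMul E) ≤ L₂ ↔
    L₀ ≤ L₂.map (zMul E) ∧ LinearMap.ker (zMul E) ≤ L₂ := by
  constructor
  · intro h
    refine ⟨fun v hv ↦ ⟨zInv E v, h ?_, zMul_zInv v⟩, fun v hv ↦ h ?_⟩
    · change zMul E _ ∈ L₀
      rwa [zMul_zInv]
    · change zMul E v ∈ L₀
      rw [LinearMap.mem_ker.1 hv]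
      exact L₀.zero_mem
  · rintro ⟨h1, h2⟩ v hv
    obtain ⟨w, hw, hwv⟩ := h1 hv
    have h3 : v - w ∈ L₂ := h2 (by rw [LinearMap.mem_ker, map_sub, hwv, sub_self])
    simpa using L₂.add_mem h3 hw

theorem mem_orthogonal_of_perpIn [L₀.HasOrthogonalProjection] (h01 : L₀ ≤ L₁) {w : Tails E}
    (h0 : w ∈ L₀ᗮ) (h1 : ∀ v ∈ perpIn L₀ L₁, inner ℂ v w = 0) : w ∈ L₁ᗮ := by
  rw [← sup_perpIn h01, ← Submodule.inf_orthogonal]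
  exact ⟨h0, (Submodule.mem_orthogonal _ _).2 h1⟩

/-- The unitary map on `z⁻¹L₀ ∩ L₀^⊥` identifies `l₁^⊥` with the part of that space orthogonal to
`L₁`. This part lies in `z⁻¹L₁ ∩ L₁^⊥`, where `C` is injective and `l₂` corresponds to `L₂ ∩ L₁^⊥`.
So `l₁^⊥ ⊆ l₂` means that this part lies in `L₂`. -/
theorem comap_zMul_le_iff_isOrtho [FiniteDimensional ℂ E] [L₀.HasOrthogonalProjection]
    [L₁.HasOrthogonalProjection] [(perpIn L₀ L₁).HasOrthogonalProjection] {k : ℕ}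
    (hk : L₀ ≤ TruncTails E k) (h01 : L₀ ≤ L₁) (h12 : L₁ ≤ L₂)
    (hz1 : L₁.map (zMul E) ≤ L₀) (hz2 : L₂.map (zMul E) ≤ L₁) :
    L₀.comap (zMul E) ≤ L₂ ↔
      ((perpIn L₀ L₁).map (residueMap E))ᗮ ⟂ ((perpIn L₁ L₂).map (residueMap E))ᗮ := by
  have hz0 : L₀.map (zMul E) ≤ L₀ := (Submodule.map_mono h01).trans hz1
  have hz1' : L₁.map (zMul E) ≤ L₁ := hz1.trans h01
  rw [Submodule.isOrtho_iff_le, Submodule.orthogonal_orthogonal]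
  constructor
  · intro h x hx
    have hw := residueInv_mem hz0 k x
    refine ⟨residueInv L₀ k x, ⟨h hw.1, ?_⟩, residueMap_residueInv hk x⟩
    refine mem_orthogonal_of_perpIn h01 hw.2 fun v hv ↦ ?_
    rw [← inner_residueMap_zPerp hz0 (perpIn_le_zPerp hz1 hv) hw, residueMap_residueInv hk]
    exact hx _ (Submodule.mem_map_of_mem hv)
  · intro h
    -- It suffices to treat `z⁻¹L₀ ∩ L₀^⊥`, because `L₀ ⊆ L₂` already. There `w` splits into `w₁ ∈
    -- L₁` and a remainder orthogonal to `L₁`, which the hypothesis places in `L₂`.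
    have hW : zPerp L₀ ≤ L₂ := by
      intro w hw
      set w₁ := (perpIn L₀ L₁).starProjection w with hw₁
      have h1 : w₁ ∈ perpIn L₀ L₁ := Submodule.starProjection_apply_mem _ _
      have h2 : w - w₁ ∈ zPerp L₀ := sub_mem hw (perpIn_le_zPerp hz1 h1)
      have h3 : ∀ v ∈ perpIn L₀ L₁, inner ℂ v (w - w₁) = 0 :=
        Submodule.sub_starProjection_mem_orthogonal w
      have h4 : residueMap E (w - w₁) ∈ ((perpIn L₀ L₁).map (residueMap E))ᗮ := by
        rintro _ ⟨v, hv, rfl⟩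
        rw [inner_residueMap_zPerp hz0 (perpIn_le_zPerp hz1 hv) h2, h3 v hv]
      obtain ⟨w₃, hw₃, h5⟩ := h h4
      have h6 : w - w₁ ∈ zPerp L₁ := ⟨h01 h2.1, mem_orthogonal_of_perpIn h01 h2.2 h3⟩
      have h7 := residueMap_injOn_zPerp hz1' (perpIn_le_zPerp hz2 hw₃) h6 h5
      have h8 : w - w₁ ∈ perpIn L₁ L₂ := h7 ▸ hw₃
      simpa using L₂.add_mem h8.1 (h12 h1.1)
    intro v hv
    have h1 : L₀.starProjection v ∈ L₀ := Submodule.starProjection_apply_mem _ _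
    have h2 : v - L₀.starProjection v ∈ zPerp L₀ :=
      ⟨sub_mem hv (hz0 (Submodule.mem_map_of_mem h1)),
        Submodule.sub_starProjection_mem_orthogonal v⟩
    simpa using L₂.add_mem (hW h2) (h12 (h01 h1))

end Perpendicular

/-! ### The bijection `Φ` -/

namespace YVar

variable {n : ℕ} {β : Fin n → ℕ}

theorem map_zMul_le (y : YVar E β) (k : Fin (n + 1)) : (y.L k).map (zMul E) ≤ y.L k := by
  refine Fin.cases ?_ (fun k ↦ (y.map_z_le k).trans (y.le_succ k)) k
  rw [y.zero_eq, Submodule.map_bot]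

theorem perpIn_le (y : YVar E β) (k : Fin n) :
    perpIn (y.L k.castSucc) (y.L k.succ) ≤ zPerp (y.L k.castSucc) :=
  perpIn_le_zPerp (y.map_z_le k)

theorem le_and_map_zMul_le (y : YVar E β) {i j : Fin (n + 1)} (hij : (j : ℕ) = i + 1) :
    y.L i ≤ y.L j ∧ (y.L j).map (zMul E) ≤ y.L i := by
  obtain ⟨i, hi⟩ := i
  obtain ⟨j, hj⟩ := j
  simp only at hij
  subst hij
  exact ⟨y.le_succ ⟨i, by omega⟩, y.map_z_le ⟨i, by omega⟩⟩

theorem ext_L {x y : YVar E β} (h : ∀ k, x.L k = y.L k) : x = y := by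
  have h' : x.L = y.L := funext h
  cases x; cases y; cases h'; rfl

/-- The chain attached to a tuple of subspaces of `E`. -/
def chainOf (q : GrassProd β E) : Fin (n + 1) → Submodule ℂ (Tails E) :=
  Fin.induction ⊥ fun k L ↦ L ⊔ chainStep L (q k).carrier

theorem chainOf_zero (q : GrassProd β E) : chainOf q 0 = ⊥ := rfl

theorem chainOf_succ (q : GrassProd β E) (k : Fin n) : chainOf q k.succ =
    chainOf q k.castSucc ⊔ chainStep (chainOf q k.castSucc) (q k).carrier := rfl

theorem map_zMul_chainStep_le (L : Submodule ℂ (Tails E)) (q : Submodule ℂ E) :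
    (chainStep L q).map (zMul E) ≤ L :=
  Submodule.map_le_iff_le_comap.2 (inf_le_left.trans inf_le_left)

theorem map_zMul_chainOf_le (q : GrassProd β E) (k : Fin (n + 1)) :
    (chainOf q k).map (zMul E) ≤ chainOf q k := by
  induction k using Fin.induction with
  | zero => rw [chainOf_zero, Submodule.map_bot]
  | succ k ih =>
    rw [chainOf_succ, Submodule.map_sup]
    exact (sup_le ih (map_zMul_chainStep_le _ _)).trans le_sup_left

theorem map_zMul_chainOf_succ_le (q : GrassProd β E) (k : Fin n) :
    (chainOf q k.succ).map (zMul E) ≤ chainOf q k.castSucc := by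
  rw [chainOf_succ, Submodule.map_sup]
  exact sup_le (map_zMul_chainOf_le q _) (map_zMul_chainStep_le _ _)

theorem chainOf_le_truncTails (q : GrassProd β E) (k : Fin (n + 1)) :
    chainOf q k ≤ TruncTails E k := by
  induction k using Fin.induction with
  | zero => rw [chainOf_zero]; exact bot_le
  | succ k ih => exact le_truncTails_succ ((map_zMul_chainOf_succ_le q k).trans ih)

theorem perpIn_chainOf (q : GrassProd β E) (k : Fin n) :
    perpIn (chainOf q k.castSucc) (chainOf q k.succ) =
      chainStep (chainOf q k.castSucc) (q k).carrier := by
  rw [chainOf_succ, perpIn_sup ((chainStep_le_zPerp _ _).trans (zPerp_le_orthogonal _))]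

variable [FiniteDimensional ℂ E]

instance finiteDimensional_L (y : YVar E β) (k : Fin (n + 1)) : FiniteDimensional ℂ (y.L k) :=
  Submodule.finiteDimensional_of_le (y.le_trunc k)

theorem finrank_perpIn (y : YVar E β) (k : Fin n) :
    Module.finrank ℂ (perpIn (y.L k.castSucc) (y.L k.succ)) = β k := by
  rw [← finrank_quotient_eq_finrank_perpIn (y.le_succ k), y.finrank_quot]

/-- The map `Φ`. -/
def toGrassProd (y : YVar E β) : GrassProd β E := fun k ↦
  { carrier := (perpIn (y.L k.castSucc) (y.L k.succ)).map (residueMap E)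
    finrank_eq := by
      rw [finrank_map_residueMap (y.map_zMul_le _) (y.perpIn_le k), y.finrank_perpIn] }

theorem L_succ_eq (y : YVar E β) (k : Fin n) : y.L k.succ =
    y.L k.castSucc ⊔ chainStep (y.L k.castSucc) (y.toGrassProd k).carrier := by
  rw [toGrassProd, chainStep_map (y.map_zMul_le _) (y.perpIn_le k), sup_perpIn (y.le_succ k)]

/-- Each `L_k` is recovered from `L_{k-1}` and the subspace `l_k` of `E`. -/
theorem toGrassProd_injective : Function.Injective (toGrassProd : YVar E β → _) := by
  intro x y h
  refine ext_L fun k ↦ ?_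
  induction k using Fin.induction with
  | zero => rw [x.zero_eq, y.zero_eq]
  | succ k ih => rw [x.L_succ_eq, y.L_succ_eq, ih, h]

instance finiteDimensional_chainOf (q : GrassProd β E) (k : Fin (n + 1)) :
    FiniteDimensional ℂ (chainOf q k) :=
  Submodule.finiteDimensional_of_le (chainOf_le_truncTails q k)

/-- The point of `Y_β` attached to a tuple of subspaces of `E`. -/
def ofGrassProd (q : GrassProd β E) : YVar E β where
  L := chainOf q
  zero_eq := chainOf_zero q
  le_succ k := by rw [chainOf_succ]; exact le_sup_left
  finrank_quot k := by
    rw [finrank_quotient_eq_finrank_perpIn (by rw [chainOf_succ]; exact le_sup_left),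
      perpIn_chainOf, ← finrank_map_residueMap (map_zMul_chainOf_le q _)
      (chainStep_le_zPerp _ _), map_chainStep (map_zMul_chainOf_le q _)
      (chainOf_le_truncTails q _), (q k).finrank_eq]
  map_z_le := map_zMul_chainOf_succ_le q

theorem toGrassProd_ofGrassProd (q : GrassProd β E) : (ofGrassProd q).toGrassProd = q := by
  funext k
  apply Grass.ext'
  change (perpIn (chainOf q k.castSucc) (chainOf q k.succ)).map (residueMap E) = _
  rw [perpIn_chainOf, map_chainStep (map_zMul_chainOf_le q _) (chainOf_le_truncTails q _)]

variable (E β) in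
/-- The bijection `Φ`. -/
def equivGrassProd : YVar E β ≃ GrassProd β E where
  toFun := toGrassProd
  invFun := ofGrassProd
  left_inv _ := toGrassProd_injective (toGrassProd_ofGrassProd _)
  right_inv := toGrassProd_ofGrassProd

theorem mem_XVar_iff (y : YVar E β) (i : ℕ) (hi : i + 1 < n) :
    y ∈ XVar E β i hi ↔ y.toGrassProd ∈ AVar E β i hi := by
  obtain ⟨h01, hz1⟩ := y.le_and_map_zMul_le (i := ⟨i, by omega⟩) (j := ⟨i + 1, by omega⟩) rfl
  obtain ⟨h12, hz2⟩ := y.le_and_map_zMul_le (i := ⟨i + 1, by omega⟩) (j := ⟨i + 2, by omega⟩) rfl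
  have : FiniteDimensional ℂ (perpIn (y.L ⟨i, by omega⟩) (y.L ⟨i + 1, by omega⟩)) :=
    Submodule.finiteDimensional_of_le (perpIn_le_right _ (y.L ⟨i + 1, by omega⟩))
  have h1 := map_zMul_le_iff_isOrtho h01 h12 hz1 hz2
  have h2 := comap_zMul_le_iff_isOrtho (y.le_trunc _) h01 h12 hz1 hz2
  rw [comap_zMul_le_iff] at h2
  by_cases h : β ⟨i, by omega⟩ + β ⟨i + 1, hi⟩ ≤ Module.finrank ℂ E
  · simp only [XVar, AVar, if_pos h]
    exact h1
  · simp only [XVar, AVar, if_neg h]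
    exact h2

theorem image_XVar (i : ℕ) (hi : i + 1 < n) :
    equivGrassProd E β '' XVar E β i hi = AVar E β i hi := by
  ext q
  rw [Equiv.image_eq_preimage_symm, Set.mem_preimage, mem_XVar_iff]
  change (equivGrassProd E β) ((equivGrassProd E β).symm q) ∈ _ ↔ _
  rw [Equiv.apply_symm_apply]

end YVar

end TailsGeometry

/-! ### Products of manifolds -/

section PiManifold

variable {ι : Type*} [Fintype ι] {E : ι → Type*} [∀ i, NormedAddCommGroup (E i)]
  [∀ i, NormedSpace ℝ (E i)] {H : ι → Type*} [∀ i, TopologicalSpace (H i)]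
  {M : ι → Type*} [∀ i, TopologicalSpace (M i)] [∀ i, ChartedSpace (H i) (M i)]
  {I : ∀ i, ModelWithCorners ℝ (E i) (H i)}
  {E' : Type*} [NormedAddCommGroup E'] [NormedSpace ℝ E'] {H' : Type*} [TopologicalSpace H']
  {N : Type*} [TopologicalSpace N] [ChartedSpace H' N] {J : ModelWithCorners ℝ E' H'}
  {f : N → ∀ i, M i} {s : Set N} {x : N}

theorem contMDiffWithinAt_pi_iff : ContMDiffWithinAt J (ModelWithCorners.pi I) ∞ f s x ↔
    ∀ i, ContMDiffWithinAt J (I i) ∞ (fun y ↦ f y i) s x := by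
  simp only [contMDiffWithinAt_iff_target (I' := ModelWithCorners.pi I), continuousWithinAt_pi,
    contMDiffWithinAt_iff_target (I' := I _), forall_and]
  exact and_congr_right fun _ ↦ contMDiffWithinAt_pi_space

theorem contMDiffOn_pi_iff : ContMDiffOn J (ModelWithCorners.pi I) ∞ f s ↔
    ∀ i, ContMDiffOn J (I i) ∞ (fun y ↦ f y i) s :=
  ⟨fun h i x hx ↦ contMDiffWithinAt_pi_iff.1 (h x hx) i,
    fun h x hx ↦ contMDiffWithinAt_pi_iff.2 fun i ↦ h i x hx⟩

theorem contMDiff_pi_iff : ContMDiff J (ModelWithCorners.pi I) ∞ f ↔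
    ∀ i, ContMDiff J (I i) ∞ (fun y ↦ f y i) := by
  simp only [← contMDiffOn_univ, contMDiffOn_pi_iff]

theorem contMDiff_eval (i : ι) :
    ContMDiff (ModelWithCorners.pi I) (I i) ∞ (fun l : ∀ i, M i ↦ l i) :=
  contMDiff_pi_iff.1 contMDiff_id i

theorem boundaryless_pi [∀ i, (I i).Boundaryless] : (ModelWithCorners.pi I).Boundaryless where
  range_eq_univ := Set.eq_univ_of_forall fun x ↦ ⟨fun i ↦ (I i).symm (x i),
    funext fun i ↦ (I i).right_inv (by simp [(I i).range_eq_univ])⟩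

/-- The velocity of a curve in a product, component by component. -/
theorem mfderiv_pi_apply {c : ℝ → ∀ i, M i} {t : ℝ}
    (hc : MDifferentiableAt 𝓘(ℝ, ℝ) (ModelWithCorners.pi I) c t) (i : ι) :
    (mfderiv 𝓘(ℝ, ℝ) (ModelWithCorners.pi I) c t (1 : ℝ) : ∀ i, E i) i =
      (mfderiv 𝓘(ℝ, ℝ) (I i) (fun s ↦ c s i) t (1 : ℝ) : E i) := by
  obtain ⟨h1, h2⟩ := hc.hasMFDerivAt
  have h3 : HasMFDerivAt 𝓘(ℝ, ℝ) (I i) (fun s ↦ c s i) t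
      ((ContinuousLinearMap.proj (R := ℝ) (φ := E) i).comp
        (mfderiv 𝓘(ℝ, ℝ) (ModelWithCorners.pi I) c t : ℝ →L[ℝ] ∀ i, E i)) :=
    ⟨continuousAt_pi.1 h1 i, hasFDerivWithinAt_pi'.1 h2 i⟩
  rw [h3.mfderiv]
  rfl

end PiManifold

/-! ### Smooth local retracts are submanifolds -/

section Retract

variable {E : Type*} [NormedAddCommGroup E] [NormedSpace ℝ E]

/-- A smooth local retraction of a Banach space can be straightened. -/
theorem exists_straightening [CompleteSpace E] {r : E → E} {U : Set E} (hU : IsOpen U)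
    (hr : ContDiffOn ℝ ∞ r U) {p : E} (hp : p ∈ U) (hrp : r p = p)
    (hrr : ∀ q ∈ U, r q ∈ U → r (r q) = r q) :
    ∃ G : OpenPartialHomeomorph E E, p ∈ G.source ∧ G.source ⊆ U ∧
      ContDiffOn ℝ ∞ G G.source ∧ ContDiffOn ℝ ∞ G.symm G.target ∧
      ∃ F : Submodule ℝ E, ∀ q ∈ G.source, r q = q ↔ G q ∈ F := by
  set P : E →L[ℝ] E := fderiv ℝ r p with hP
  have hdr : HasFDerivAt r P p :=
    ((hr.contDiffAt (hU.mem_nhds hp)).differentiableAt (by simp)).hasFDerivAt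
  have hPP : P.comp P = P := by
    -- Differentiating `r ∘ r = r` at the fixed point `p` shows that `P` is idempotent.
    have h1 : HasFDerivAt (r ∘ r) (P.comp P) p := by
      refine HasFDerivAt.comp p ?_ hdr
      rwa [hrp]
    have h2 : r ∘ r =ᶠ[𝓝 p] r := by
      have h3 : ∀ᶠ q in 𝓝 p, r q ∈ U :=
        hdr.continuousAt.eventually (by rw [hrp]; exact hU.mem_nhds hp)
      filter_upwards [h3, hU.mem_nhds hp] with q hq hq'
      exact hrr q hq' hq
    exact (h1.congr_of_eventuallyEq h2.symm).unique hdr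
  have hPP' : ∀ x, P (P x) = P x := fun x ↦ congrArg (fun T : E →L[ℝ] E ↦ T x) hPP
  -- In the splitting `E = im P ⊕ ker P`, use `r y` for the first coordinate and `y - r y` for the
  -- second. The derivative at `p` is `P² + (1 - P)² = 1`, so `g` is a local diffeomorphism.
  set g : E → E := fun y ↦ P (r y) + ((y - r y) - P (y - r y)) with hg
  have hgs : ContDiffOn ℝ ∞ g U :=
    (P.contDiff.comp_contDiffOn hr).add
      ((contDiffOn_id.sub hr).sub (P.contDiff.comp_contDiffOn (contDiffOn_id.sub hr)))
  have hdg : HasFDerivAt g ((ContinuousLinearEquiv.refl ℝ E : E ≃L[ℝ] E) : E →L[ℝ] E) p := by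
    have h1 : HasFDerivAt (fun y ↦ y - r y) (ContinuousLinearMap.id ℝ E - P) p :=
      (hasFDerivAt_id p).sub hdr
    have h2 := (P.hasFDerivAt.comp p hdr).add (h1.sub (P.hasFDerivAt.comp p h1))
    refine h2.congr_fderiv ?_
    ext x
    simp [hPP']
  have hgp : ContDiffAt ℝ ∞ g p := hgs.contDiffAt (hU.mem_nhds hp)
  set G₁ := hgp.toOpenPartialHomeomorph g hdg (by simp) with hG₁
  have hG₁c : ∀ q, G₁ q = g q := fun _ ↦ rfl
  -- Invertibility of the derivative is imposed at every point, so that the inverse is smooth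
  -- throughout the domain.
  set V : Set E := G₁.source ∩ (U ∩ fderiv ℝ g ⁻¹'
    Set.range ((↑) : (E ≃L[ℝ] E) → E →L[ℝ] E)) with hV
  have hVo : IsOpen V := G₁.open_source.inter
    ((hgs.continuousOn_fderiv_of_isOpen hU (by simp)).isOpen_inter_preimage hU
      ContinuousLinearEquiv.isOpen)
  have hpV : p ∈ V := ⟨hgp.mem_toOpenPartialHomeomorph_source hdg (by simp), hp,
    ContinuousLinearEquiv.refl ℝ E, hdg.fderiv.symm⟩
  -- For `q` in `V'` the point `r q` also lies in the domain where `g` is injective; this is needed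
  -- to compare `g (r q)` with `g q`.
  set V' : Set E := V ∩ r ⁻¹' V with hV'
  have hV'o : IsOpen V' :=
    (hr.continuousOn.mono fun q hq ↦ hq.2.1).isOpen_inter_preimage hVo hVo
  have hpV' : p ∈ V' := ⟨hpV, by rw [Set.mem_preimage, hrp]; exact hpV⟩
  have hsrc : (G₁.restrOpen V' hV'o).source = V' := by
    rw [OpenPartialHomeomorph.restrOpen_source]
    exact Set.inter_eq_right.2 fun q hq ↦ hq.1.1
  refine ⟨G₁.restrOpen V' hV'o, by rw [hsrc]; exact hpV', by rw [hsrc]; exact fun q hq ↦ hq.1.2.1,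
    by rw [hsrc]; exact hgs.mono fun q hq ↦ hq.1.2.1, ?_, LinearMap.range (P : E →ₗ[ℝ] E), ?_⟩
  · intro a ha
    have ha1 := (G₁.restrOpen V' hV'o).map_target ha
    rw [hsrc] at ha1
    change G₁.symm a ∈ V' at ha1
    have ha2 : a ∈ G₁.target := ha.1
    obtain ⟨e, he⟩ := ha1.1.2.2
    have h1 : ContDiffAt ℝ ∞ g (G₁.symm a) := hgs.contDiffAt (hU.mem_nhds ha1.1.2.1)
    refine (G₁.contDiffAt_symm ha2 (f₀' := e) ?_ h1).contDiffWithinAt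
    rw [he]
    exact (h1.differentiableAt (by simp)).hasFDerivAt
  · rw [hsrc]
    intro q hq
    change r q = q ↔ g q ∈ _
    constructor
    · intro h
      exact ⟨q, by simp [hg, h]⟩
    · rintro ⟨x, hx⟩
      have h1 : P (g q) = g q := by rw [← hx]; exact hPP' x
      have h2 : P (g q) = P (r q) := by simp [hg, hPP']
      have h3 : r (r q) = r q := hrr q hq.1.2.1 hq.2.2.1
      -- If `g q` lies in `im P` then `g q = P (g q) = P (r q) = g (r q)`, and injectivity gives `r
      -- q = q`.
      have h4 : g (r q) = g q := by
        rw [← h1, h2]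
        simp [hg, h3]
      exact G₁.injOn hq.2.1 hq.1.1 h4

variable {H : Type*} [TopologicalSpace H] {I : ModelWithCorners ℝ E H}
  {M : Type*} [TopologicalSpace M] [ChartedSpace H M]

/-- A subset of a manifold which is locally a smooth retract is a submanifold. -/
theorem isSubmanifold_of_retract [CompleteSpace E] [I.Boundaryless] [IsManifold I ∞ M] {S : Set M}
    (h : ∀ p ∈ S, ∃ U : Set M, IsOpen U ∧ p ∈ U ∧ ∃ r : M → M, ContMDiffOn I I ∞ r U ∧
      (∀ q ∈ U, r q ∈ S) ∧ ∀ q ∈ U, q ∈ S → r q = q) : IsSubmanifold I S := by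
  intro p hpS
  obtain ⟨U, hU, hpU, r, hr, hrS, hrq⟩ := h p hpS
  set e := extChartAt I p with he
  have hUr : IsOpen (U ∩ r ⁻¹' e.source) :=
    hr.continuousOn.isOpen_inter_preimage hU (isOpen_extChartAt_source p)
  set U' : Set E := e.target ∩ e.symm ⁻¹' (U ∩ r ⁻¹' e.source) with hU'
  have hU'o : IsOpen U' :=
    (continuousOn_extChartAt_symm p).isOpen_inter_preimage (isOpen_extChartAt_target p) hUr
  have hpp : e.symm (e p) = p := extChartAt_to_inv p
  have hrp : r p = p := hrq p hpU hpS
  have hr' : ContDiffOn ℝ ∞ (e ∘ r ∘ e.symm) U' := by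
    rw [← contMDiffOn_iff_contDiffOn]
    have h1 : ContMDiffOn 𝓘(ℝ, E) I ∞ e.symm U' :=
      (contMDiffOn_extChartAt_symm p).mono fun q hq ↦ hq.1
    have h2 : ContMDiffOn 𝓘(ℝ, E) I ∞ (r ∘ e.symm) U' := hr.comp h1 fun q hq ↦ hq.2.1
    exact (contMDiffOn_extChartAt (I := I) (x := p)).comp h2
      fun q hq ↦ by rw [← extChartAt_source I]; exact hq.2.2
  obtain ⟨G, hpG, hGU, hG, hG', F, hF⟩ := exists_straightening hU'o hr' (p := e p)
    ⟨mem_extChartAt_target p, by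
      rw [Set.mem_preimage, hpp]
      exact ⟨hpU, by rw [Set.mem_preimage, hrp]; exact mem_extChartAt_source p⟩⟩
    (by simp [hpp, hrp]) (by
      intro q hq hq'
      have h1 : e.symm (e (r (e.symm q))) = r (e.symm q) := e.left_inv hq.2.2
      have h2 : r (e.symm q) ∈ U := h1 ▸ hq'.2.1
      simp only [Function.comp_apply, h1, hrq _ h2 (hrS _ hq.2.1)])
  set ψ := I.toHomeomorph with hψ
  set φ : OpenPartialHomeomorph M H :=
    chartAt H p ≫ₕ (ψ.toOpenPartialHomeomorph ≫ₕ (G ≫ₕ ψ.symm.toOpenPartialHomeomorph)) with hφ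
  have hsrc : ∀ q, q ∈ φ.source ↔ q ∈ (chartAt H p).source ∧ e q ∈ G.source := by
    intro q
    simp [hφ, hψ, he, ModelWithCorners.toHomeomorph, extChartAt]
  have hφq : ∀ q, φ q = I.symm (G (e q)) := fun q ↦ rfl
  refine ⟨φ, ?_, (hsrc p).2 ⟨mem_chart_source H p, hpG⟩, F, ?_⟩
  · apply OpenPartialHomeomorph.mem_maximalAtlas_of_contMDiffOn
    · have h1 : ContMDiffOn I 𝓘(ℝ, E) ∞ e φ.source :=
        (contMDiffOn_extChartAt (I := I) (x := p)).mono fun q hq ↦ ((hsrc q).1 hq).1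
      have h2 : ContMDiffOn I 𝓘(ℝ, E) ∞ (fun q ↦ G (e q)) φ.source :=
        hG.contMDiffOn.comp h1 fun q hq ↦ ((hsrc q).1 hq).2
      exact I.contMDiffOn_symm.comp h2 fun q _ ↦ by simp [I.range_eq_univ]
    · have h1 : ContMDiffOn I 𝓘(ℝ, E) ∞ I φ.target := I.contMDiff.contMDiffOn
      have htgt : ∀ a ∈ φ.target, I a ∈ G.target ∧ G.symm (I a) ∈ e.target := by
        intro a ha
        have h3 := φ.map_target ha
        rw [hsrc] at h3
        have h4 := φ.right_inv ha
        have h5 : G (e (φ.symm a)) = I a := by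
          have h6 := congrArg I h4
          rwa [hφq, I.right_inv (by simp [I.range_eq_univ])] at h6
        rw [← h5]
        exact ⟨G.map_source h3.2, by
          rw [G.left_inv h3.2]
          exact e.map_source (by rw [extChartAt_source]; exact h3.1)⟩
      have h2 : ContMDiffOn I 𝓘(ℝ, E) ∞ (fun a ↦ G.symm (I a)) φ.target :=
        hG'.contMDiffOn.comp h1 fun a ha ↦ (htgt a ha).1
      exact (contMDiffOn_extChartAt_symm (I := I) p).comp h2 fun a ha ↦ (htgt a ha).2
  · intro q hq
    obtain ⟨hq1, hq2⟩ := (hsrc q).1 hq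
    have h1 : φ.extend I q = G (e q) := by
      change I (φ q) = _
      rw [hφq, I.right_inv (by simp [I.range_eq_univ])]
    have h2 : e.symm (e q) = q := e.left_inv (by rw [extChartAt_source]; exact hq1)
    have h3 := (hGU hq2).2
    rw [Set.mem_preimage, h2] at h3
    rw [h1, ← hF _ hq2]
    simp only [Function.comp_apply, h2]
    constructor
    · intro hqS; rw [hrq q h3.1 hqS]
    · intro h4
      have h5 : r q = q := e.injOn h3.2 (by rw [extChartAt_source]; exact hq1) h4
      rw [← h5]; exact hrS q h3.1

end Retract

/-! ### Smooth maps into and out of Grassmannians: frames, ranges, orthogonal projections. -/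

namespace Grass

section Charts

variable {k : ℕ} {V : Type*} [AddCommGroup V] [Module ℂ V] [FiniteDimensional ℂ V]

/-- A graph chart as an open partial homeomorphism. -/
def openChart (φ : V ≃ₗ[ℂ] (Fin k → ℂ) × (Fin (Module.finrank ℂ V - k) → ℂ)) :
    OpenPartialHomeomorph (Grass k V) (Model k (Module.finrank ℂ V - k)) :=
  (chartedSpaceCore k V).openPartialHomeomorph (chart φ) (Set.mem_range_self φ)

theorem openChart_mem_maximalAtlas
    (φ : V ≃ₗ[ℂ] (Fin k → ℂ) × (Fin (Module.finrank ℂ V - k) → ℂ)) :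
    openChart φ ∈ IsManifold.maximalAtlas 𝓘(ℝ, Model k (Module.finrank ℂ V - k)) ∞ (Grass k V) := by
  apply IsManifold.subset_maximalAtlas
  change openChart φ ∈ ⋃ (e : PartialEquiv _ _) (he : e ∈ (chartedSpaceCore k V).atlas),
    {(chartedSpaceCore k V).openPartialHomeomorph e he}
  simp only [Set.mem_iUnion, Set.mem_singleton_iff]
  exact ⟨chart φ, Set.mem_range_self φ, rfl⟩

theorem contMDiff_ofGraph (φ : V ≃ₗ[ℂ] (Fin k → ℂ) × (Fin (Module.finrank ℂ V - k) → ℂ)) :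
    ContMDiff 𝓘(ℝ, Model k (Module.finrank ℂ V - k)) 𝓘(ℝ, Model k (Module.finrank ℂ V - k)) ∞
      (ofGraph φ) := by
  rw [← contMDiffOn_univ]
  exact contMDiffOn_symm_of_mem_maximalAtlas (openChart_mem_maximalAtlas φ)

theorem contMDiffOn_chart (φ : V ≃ₗ[ℂ] (Fin k → ℂ) × (Fin (Module.finrank ℂ V - k) → ℂ)) :
    ContMDiffOn 𝓘(ℝ, Model k (Module.finrank ℂ V - k)) 𝓘(ℝ, Model k (Module.finrank ℂ V - k)) ∞
      (chart φ) (chart φ).source :=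
  contMDiffOn_of_mem_maximalAtlas (openChart_mem_maximalAtlas φ)

theorem isOpen_chart_source (φ : V ≃ₗ[ℂ] (Fin k → ℂ) × (Fin (Module.finrank ℂ V - k) → ℂ)) :
    IsOpen (chart (k := k) φ).source :=
  (openChart φ).open_source

end Charts

variable {E' : Type*} [NormedAddCommGroup E'] [NormedSpace ℝ E'] {H' : Type*} [TopologicalSpace H']
  {N : Type*} [TopologicalSpace N] [ChartedSpace H' N] {I : ModelWithCorners ℝ E' H'}

section Frames

variable {k : ℕ} {V : Type*} [NormedAddCommGroup V] [NormedSpace ℂ V] [FiniteDimensional ℂ V]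

theorem contDiff_comp_clm {F₁ F₂ F₃ : Type*} [NormedAddCommGroup F₁] [NormedSpace ℂ F₁]
    [NormedAddCommGroup F₂] [NormedSpace ℂ F₂] [NormedAddCommGroup F₃] [NormedSpace ℂ F₃] :
    ContDiff ℝ ∞ (fun p : (F₂ →L[ℂ] F₃) × (F₁ →L[ℂ] F₂) ↦ p.1.comp p.2) :=
  (ContDiff.clm_comp (𝕜 := ℂ) contDiff_fst contDiff_snd).restrict_scalars ℝ

theorem contMDiffWithinAt_clm_comp {F₁ F₂ F₃ : Type*} [NormedAddCommGroup F₁] [NormedSpace ℂ F₁]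
    [NormedAddCommGroup F₂] [NormedSpace ℂ F₂] [NormedAddCommGroup F₃] [NormedSpace ℂ F₃]
    {A : N → F₂ →L[ℂ] F₃} {B : N → F₁ →L[ℂ] F₂} {s : Set N} {x : N}
    (hA : ContMDiffWithinAt I 𝓘(ℝ, F₂ →L[ℂ] F₃) ∞ A s x)
    (hB : ContMDiffWithinAt I 𝓘(ℝ, F₁ →L[ℂ] F₂) ∞ B s x) :
    ContMDiffWithinAt I 𝓘(ℝ, F₁ →L[ℂ] F₃) ∞ (fun y ↦ (A y).comp (B y)) s x :=
  contDiff_comp_clm.contMDiff.contMDiffAt.comp_contMDiffWithinAt x (hA.prodMk_space hB)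

theorem contMDiff_clm_comp {F₁ F₂ F₃ : Type*} [NormedAddCommGroup F₁] [NormedSpace ℂ F₁]
    [NormedAddCommGroup F₂] [NormedSpace ℂ F₂] [NormedAddCommGroup F₃] [NormedSpace ℂ F₃]
    {A : N → F₂ →L[ℂ] F₃} {B : N → F₁ →L[ℂ] F₂} (hA : ContMDiff I 𝓘(ℝ, F₂ →L[ℂ] F₃) ∞ A)
    (hB : ContMDiff I 𝓘(ℝ, F₁ →L[ℂ] F₂) ∞ B) :
    ContMDiff I 𝓘(ℝ, F₁ →L[ℂ] F₃) ∞ (fun y ↦ (A y).comp (B y)) :=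
  fun x ↦ contMDiffWithinAt_clm_comp (hA x) (hB x)

theorem contMDiffAt_ringInverse {F : Type*} [NormedAddCommGroup F] [NormedSpace ℂ F]
    [CompleteSpace F] {A : N → F →L[ℂ] F} {x : N} (hA : ContMDiffAt I 𝓘(ℝ, F →L[ℂ] F) ∞ A x)
    (hx : IsUnit (A x)) : ContMDiffAt I 𝓘(ℝ, F →L[ℂ] F) ∞ (fun y ↦ Ring.inverse (A y)) x := by
  obtain ⟨u, hu⟩ := hx
  have h2 := (contDiffAt_ringInverse ℂ (n := ∞) u).restrict_scalars ℝ
  rw [hu] at h2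
  exact h2.contMDiffAt.comp x hA

/-- A map to a Grassmannian which locally has a smooth frame is smooth. -/
theorem contMDiffAt_of_frame {f : N → Grass k V} {B : N → (Fin k → ℂ) →L[ℂ] V} {x : N}
    (hB : ContMDiffAt I 𝓘(ℝ, (Fin k → ℂ) →L[ℂ] V) ∞ B x)
    (h : ∀ᶠ y in 𝓝 x, (f y).carrier = (B y : (Fin k → ℂ) →ₗ[ℂ] V).range) :
    ContMDiffAt I 𝓘(ℝ, Model k (Module.finrank ℂ V - k)) ∞ f x := by
  obtain ⟨φ, hφ⟩ := exists_chart (f x)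
  let φ' : V →L[ℂ] (Fin k → ℂ) × (Fin (Module.finrank ℂ V - k) → ℂ) :=
    LinearMap.toContinuousLinearMap (φ : V →ₗ[ℂ] _)
  let D₁ : N → (Fin k → ℂ) →L[ℂ] (Fin k → ℂ) := fun y ↦
    ((ContinuousLinearMap.fst ℂ _ _).comp φ').comp (B y)
  let D₂ : N → (Fin k → ℂ) →L[ℂ] (Fin (Module.finrank ℂ V - k) → ℂ) := fun y ↦
    ((ContinuousLinearMap.snd ℂ _ _).comp φ').comp (B y)
  have hD₁ : ContMDiffAt I 𝓘(ℝ, (Fin k → ℂ) →L[ℂ] (Fin k → ℂ)) ∞ D₁ x :=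
    contMDiffWithinAt_clm_comp contMDiffWithinAt_const hB
  have hD₂ : ContMDiffAt I 𝓘(ℝ, Model k (Module.finrank ℂ V - k)) ∞ D₂ x :=
    contMDiffWithinAt_clm_comp contMDiffWithinAt_const hB
  -- Where the `ℂᵏ`-component `D₁` of the frame is invertible, its range is the graph of `D₂ D₁⁻¹`.
  have hgr : ∀ y, (f y).carrier = (B y : (Fin k → ℂ) →ₗ[ℂ] V).range → IsUnit (D₁ y) →
      f y = ofGraph φ ((D₂ y).comp (Ring.inverse (D₁ y))) := by
    intro y hy hu
    refine ext' (Submodule.eq_of_le_of_finrank_eq ?_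
      ((f y).finrank_eq.trans (ofGraph φ _).finrank_eq.symm))
    rw [hy]
    rintro _ ⟨v, rfl⟩
    rw [mem_ofGraph]
    have h1 : Ring.inverse (D₁ y) (D₁ y v) = v :=
      congrArg (fun T : (Fin k → ℂ) →L[ℂ] (Fin k → ℂ) ↦ T v) (Ring.inverse_mul_cancel _ hu)
    change D₂ y v = D₂ y (Ring.inverse (D₁ y) (D₁ y v))
    rw [h1]
  -- `B x` is injective because its range has dimension `k`, and the first coordinate is injective
  -- on a graph.
  have hux : IsUnit (D₁ x) := by
    have hx := h.self_of_nhds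
    have hinj : Function.Injective (B x) := by
      have h1 : Module.finrank ℂ (B x : (Fin k → ℂ) →ₗ[ℂ] V).range = k := by
        rw [← hx, (f x).finrank_eq]
      have h2 := LinearMap.finrank_range_add_finrank_ker (B x : (Fin k → ℂ) →ₗ[ℂ] V)
      rw [h1, Module.finrank_fin_fun, Nat.add_eq_left, Submodule.finrank_eq_zero] at h2
      exact LinearMap.ker_eq_bot.1 h2
    rw [chart_source] at hφ
    obtain ⟨A, hA⟩ := hφ
    have hinj' : Function.Injective (D₁ x) := by
      rw [injective_iff_map_eq_zero]
      intro v hv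
      have h3 : B x v ∈ (ofGraph φ A).carrier := by rw [hA, hx]; exact ⟨v, rfl⟩
      rw [mem_ofGraph] at h3
      have h4 : (φ (B x v)).1 = 0 := hv
      rw [h4, map_zero] at h3
      have h5 : φ (B x v) = 0 := Prod.ext h4 h3
      rw [LinearEquiv.map_eq_zero_iff] at h5
      exact hinj (h5.trans (map_zero _).symm)
    rw [ContinuousLinearMap.isUnit_iff_bijective]
    exact ⟨hinj', LinearMap.injective_iff_surjective (f := (D₁ x).toLinearMap).1 hinj'⟩
  have hopen : ∀ᶠ y in 𝓝 x, IsUnit (D₁ y) :=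
    hD₁.continuousAt.eventually (Units.isOpen.mem_nhds hux)
  have heq : f =ᶠ[𝓝 x] fun y ↦ ofGraph φ ((D₂ y).comp (Ring.inverse (D₁ y))) := by
    filter_upwards [h, hopen] with y h1 h2 using hgr y h1 h2
  refine ContMDiffAt.congr_of_eventuallyEq ?_ heq
  exact (contMDiff_ofGraph φ).contMDiffAt.comp x
    (contMDiffWithinAt_clm_comp hD₂ (contMDiffAt_ringInverse hD₁ hux))

/-- A smooth family of linear maps `T y` has, locally, a smooth choice of a subspace of its range
with a prescribed value at a point. -/
theorem exists_contMDiffOn_le_range {F : Type*} [NormedAddCommGroup F] [NormedSpace ℂ F]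
    {T : N → F →L[ℂ] V} (hT : ContMDiff I 𝓘(ℝ, F →L[ℂ] V) ∞ T) (x : N) (W : Grass k V)
    (hW : W.carrier ≤ (T x : F →ₗ[ℂ] V).range) :
    ∃ U : Set N, IsOpen U ∧ x ∈ U ∧ ∃ f : N → Grass k V,
      ContMDiffOn I 𝓘(ℝ, Model k (Module.finrank ℂ V - k)) ∞ f U ∧ f x = W ∧
      ∀ y ∈ U, (f y).carrier ≤ (T y : F →ₗ[ℂ] V).range := by
  classical
  -- Lift a basis of `W` through `T x` to vectors `u i`; the span of the vectors `T y (u i)` is the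
  -- required family, as long as they remain independent.
  let b : Module.Basis (Fin k) ℂ W.carrier := Module.finBasisOfFinrankEq ℂ _ W.finrank_eq
  choose u hu using fun i ↦ hW (b i).2
  let e : (Fin k → ℂ) →L[ℂ] F := LinearMap.toContinuousLinearMap (Fintype.linearCombination ℂ u)
  let j : (Fin k → ℂ) →ₗ[ℂ] V := W.carrier.subtype ∘ₗ (b.equivFun.symm : (Fin k → ℂ) →ₗ[ℂ] _)
  have hj : (((T x).comp e : (Fin k → ℂ) →L[ℂ] V) : (Fin k → ℂ) →ₗ[ℂ] V) = j := by
    ext i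
    simp only [e, j, LinearMap.comp_apply, LinearMap.coe_single]
    simpa [Fintype.linearCombination_apply, Pi.single_apply, ite_smul] using hu i
  have hjinj : Function.Injective j := W.carrier.subtype_injective.comp b.equivFun.symm.injective
  obtain ⟨R, hR⟩ := j.exists_leftInverse_of_injective (LinearMap.ker_eq_bot.2 hjinj)
  let B : N → (Fin k → ℂ) →L[ℂ] V := fun y ↦ (T y).comp e
  have hB : ContMDiff I 𝓘(ℝ, (Fin k → ℂ) →L[ℂ] V) ∞ B := contMDiff_clm_comp hT contMDiff_const
  -- `R` is a left inverse of the frame at `x`, so `D x = 1`, and invertibility of `D y` is an open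
  -- condition that keeps `B y` injective.
  let D : N → (Fin k → ℂ) →L[ℂ] (Fin k → ℂ) := fun y ↦ (LinearMap.toContinuousLinearMap R).comp (B y)
  have hD : ContMDiff I 𝓘(ℝ, (Fin k → ℂ) →L[ℂ] (Fin k → ℂ)) ∞ D :=
    contMDiff_clm_comp contMDiff_const hB
  have hfr : ∀ y, IsUnit (D y) → Module.finrank ℂ (B y : (Fin k → ℂ) →ₗ[ℂ] V).range = k := by
    intro y hy
    rw [LinearMap.finrank_range_of_inj, Module.finrank_fin_fun]
    exact Function.Injective.of_comp (f := R) ((ContinuousLinearMap.isUnit_iff_bijective.1 hy).1)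
  let f : N → Grass k V := fun y ↦
    if h : Module.finrank ℂ (B y : (Fin k → ℂ) →ₗ[ℂ] V).range = k then ⟨_, h⟩ else W
  have hf : ∀ y, IsUnit (D y) → (f y).carrier = (B y : (Fin k → ℂ) →ₗ[ℂ] V).range := by
    intro y hy
    simp only [f, dif_pos (hfr y hy)]
  have hUo : IsOpen {y | IsUnit (D y)} := Units.isOpen.preimage hD.continuous
  have hx : IsUnit (D x) := by
    have h1 : D x = 1 := by
      ext1 v
      exact (congrArg (fun g ↦ R (g v)) hj).trans (congrArg (fun g ↦ g v) hR)
    rw [h1]; exact isUnit_one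
  refine ⟨_, hUo, hx, f, ?_, ?_, ?_⟩
  · intro y hy
    refine (contMDiffAt_of_frame hB.contMDiffAt ?_).contMDiffWithinAt
    filter_upwards [hUo.mem_nhds hy] with z hz using hf z hz
  · apply ext'
    rw [hf x hx]
    change LinearMap.range (((T x).comp e : (Fin k → ℂ) →L[ℂ] V) : (Fin k → ℂ) →ₗ[ℂ] V) = _
    rw [hj, LinearMap.range_comp]
    simp
  · intro y hy
    rw [hf y hy]
    rintro _ ⟨v, rfl⟩
    exact ⟨e v, rfl⟩

/-- A map to a Grassmannian given by the ranges of a smooth family of linear maps is smooth. -/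
theorem contMDiff_of_range {F : Type*} [NormedAddCommGroup F] [NormedSpace ℂ F]
    {T : N → F →L[ℂ] V} (hT : ContMDiff I 𝓘(ℝ, F →L[ℂ] V) ∞ T) {f : N → Grass k V}
    (h : ∀ x, (f x).carrier = (T x : F →ₗ[ℂ] V).range) :
    ContMDiff I 𝓘(ℝ, Model k (Module.finrank ℂ V - k)) ∞ f := by
  intro x
  obtain ⟨U, hU, hxU, g, hg, -, hgT⟩ := exists_contMDiffOn_le_range hT x (f x) (h x).le
  refine (hg.contMDiffAt (hU.mem_nhds hxU)).congr_of_eventuallyEq ?_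
  filter_upwards [hU.mem_nhds hxU] with y hy
  exact (ext' (Submodule.eq_of_le_of_finrank_eq ((hgT y hy).trans (h y).ge)
    ((g y).finrank_eq.trans (f y).finrank_eq.symm))).symm

end Frames

section Projections

variable {k : ℕ} {V : Type*} [NormedAddCommGroup V] [InnerProductSpace ℂ V]
  [FiniteDimensional ℂ V]

/-- The adjoint is conjugate-linear, hence bounded and linear over `ℝ`; this is why smoothness is
taken over `ℝ`. -/
theorem contDiff_adjoint {F₁ F₂ : Type*} [NormedAddCommGroup F₁] [InnerProductSpace ℂ F₁]
    [CompleteSpace F₁] [NormedAddCommGroup F₂] [InnerProductSpace ℂ F₂] [CompleteSpace F₂] :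
    ContDiff ℝ ∞ (fun T : F₁ →L[ℂ] F₂ ↦ ContinuousLinearMap.adjoint T) := by
  refine IsBoundedLinearMap.contDiff (𝕜 := ℝ) ⟨⟨fun S T ↦ map_add _ S T, fun c T ↦ ?_⟩, 1,
    one_pos, fun T ↦ ?_⟩
  · have h : c • T = (c : ℂ) • T := by ext x; simp
    rw [h, map_smulₛₗ]
    ext x; simp
  · rw [one_mul, LinearIsometryEquiv.norm_map]

/-- The orthogonal projection onto the range of an injective linear map. -/
theorem starProjection_range {F : Type*} [NormedAddCommGroup F] [InnerProductSpace ℂ F]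
    [FiniteDimensional ℂ F] (B : F →L[ℂ] V) (hB : Function.Injective B) :
    IsUnit (B.adjoint.comp B) ∧ (B : F →ₗ[ℂ] V).range.starProjection =
      (B.comp (Ring.inverse (B.adjoint.comp B))).comp B.adjoint := by
  have hu : IsUnit (B.adjoint.comp B) := by
    have hinj : Function.Injective (B.adjoint.comp B) := by
      rw [injective_iff_map_eq_zero]
      intro x hx
      have h1 : inner ℂ (B x) (B x) = 0 := by
        rw [← ContinuousLinearMap.adjoint_inner_right]
        change inner ℂ x ((B.adjoint.comp B) x) = 0
        rw [hx, inner_zero_right]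
      rw [inner_self_eq_zero] at h1
      exact hB (h1.trans (map_zero B).symm)
    rw [ContinuousLinearMap.isUnit_iff_bijective]
    exact ⟨hinj, LinearMap.injective_iff_surjective
      (f := (B.adjoint.comp B).toLinearMap).1 hinj⟩
  refine ⟨hu, ?_⟩
  ext1 v
  refine Submodule.eq_starProjection_of_mem_orthogonal (LinearMap.mem_range_self (B : F →ₗ[ℂ] V)
    (Ring.inverse (B.adjoint.comp B) (B.adjoint v))) ?_
  rintro _ ⟨x, rfl⟩
  have h1 : (B.adjoint.comp B) (Ring.inverse (B.adjoint.comp B) (B.adjoint v)) = B.adjoint v :=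
    congrArg (fun T : F →L[ℂ] F ↦ T (B.adjoint v)) (Ring.mul_inverse_cancel _ hu)
  change inner ℂ (B x) (v - B (Ring.inverse (B.adjoint.comp B) (B.adjoint v))) = 0
  rw [ContinuousLinearMap.comp_apply] at h1
  rw [← ContinuousLinearMap.adjoint_inner_right, map_sub, h1, sub_self, inner_zero_right]

/-- The orthogonal projection onto a subspace depends smoothly on the subspace. -/
theorem contMDiff_starProjection : ContMDiff 𝓘(ℝ, Model k (Module.finrank ℂ V - k))
    𝓘(ℝ, V →L[ℂ] V) ∞ (fun W : Grass k V ↦ (W.carrier.starProjection : V →L[ℂ] V)) := by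
  intro W
  obtain ⟨φ, hφ⟩ := exists_chart W
  let φ' : (Fin k → ℂ) × (Fin (Module.finrank ℂ V - k) → ℂ) →L[ℂ] V :=
    LinearMap.toContinuousLinearMap (φ.symm : _ →ₗ[ℂ] V)
  -- The frame is given a Euclidean source so that its adjoint, and with it `B(B*B)⁻¹B*`, makes
  -- sense.
  let e : EuclideanSpace ℂ (Fin k) ≃L[ℂ] (Fin k → ℂ) := EuclideanSpace.equiv (Fin k) ℂ
  let B : Model k (Module.finrank ℂ V - k) → EuclideanSpace ℂ (Fin k) →L[ℂ] V := fun A ↦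
    (φ'.comp ((ContinuousLinearMap.id ℂ (Fin k → ℂ)).prod A)).comp
      (e : EuclideanSpace ℂ (Fin k) →L[ℂ] (Fin k → ℂ))
  have hB : ContMDiff 𝓘(ℝ, Model k (Module.finrank ℂ V - k))
      𝓘(ℝ, EuclideanSpace ℂ (Fin k) →L[ℂ] V) ∞ B :=
    contMDiff_clm_comp (contMDiff_clm_comp contMDiff_const contDiff_idProd.contMDiff)
      contMDiff_const
  have hBinj : ∀ A, Function.Injective (B A) := by
    intro A x y hxy
    exact e.injective (congrArg Prod.fst (φ.symm.injective hxy))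
  have hBr : ∀ A, (ofGraph φ A).carrier = (B A : EuclideanSpace ℂ (Fin k) →ₗ[ℂ] V).range := by
    intro A
    symm
    apply Submodule.eq_of_le_of_finrank_eq
    · rintro _ ⟨x, rfl⟩
      rw [mem_ofGraph]
      change (φ (φ.symm (e x, A (e x)))).2 = A (φ (φ.symm (e x, A (e x)))).1
      simp
    · rw [(ofGraph φ A).finrank_eq, LinearMap.finrank_range_of_inj (hBinj A),
        finrank_euclideanSpace_fin]
  have hadj : ContMDiff 𝓘(ℝ, Model k (Module.finrank ℂ V - k))
      𝓘(ℝ, V →L[ℂ] EuclideanSpace ℂ (Fin k)) ∞ (fun A ↦ (B A).adjoint) :=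
    contDiff_adjoint.contMDiff.comp hB
  have hP : ContMDiff 𝓘(ℝ, Model k (Module.finrank ℂ V - k)) 𝓘(ℝ, V →L[ℂ] V) ∞
      (fun A ↦ ((B A).comp (Ring.inverse ((B A).adjoint.comp (B A)))).comp (B A).adjoint) := by
    refine contMDiff_clm_comp (contMDiff_clm_comp hB fun A ↦ ?_) hadj
    exact contMDiffAt_ringInverse (contMDiff_clm_comp hadj hB A)
      (starProjection_range (B A) (hBinj A)).1
  have h1 : ContMDiffAt 𝓘(ℝ, Model k (Module.finrank ℂ V - k))
      𝓘(ℝ, Model k (Module.finrank ℂ V - k)) ∞ (chart φ) W :=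
    (contMDiffOn_chart φ).contMDiffAt ((isOpen_chart_source φ).mem_nhds hφ)
  refine (hP.contMDiffAt.comp W h1).congr_of_eventuallyEq ?_
  filter_upwards [(isOpen_chart_source φ).mem_nhds hφ] with W' hW'
  have h2 : W' = ofGraph φ (chart φ W') := ((chart φ).left_inv hW').symm
  have h3 : W'.carrier = (B (chart φ W') : EuclideanSpace ℂ (Fin k) →ₗ[ℂ] V).range := by
    rw [← hBr, ← h2]
  simp only [Function.comp_apply]
  rw [← (starProjection_range (B (chart φ W')) (hBinj _)).2]
  simp only [h3]

end Projections

end Grass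

/-! ### Pairs of perpendicular subspaces -/

namespace Grass

variable {k k' : ℕ} {V : Type*} [NormedAddCommGroup V] [InnerProductSpace ℂ V]
  [FiniteDimensional ℂ V]

/-- The orthogonal complement. -/
def perp (h : k + k' = Module.finrank ℂ V) (W : Grass k V) : Grass k' V where
  carrier := W.carrierᗮ
  finrank_eq := by
    have := W.carrier.finrank_add_finrank_orthogonal
    rw [W.finrank_eq] at this
    omega

/-- `W^⊥` is the range of `1 - P_W`, which is smooth in `W`. -/
theorem contMDiff_perp (h : k + k' = Module.finrank ℂ V) :
    ContMDiff 𝓘(ℝ, Model k (Module.finrank ℂ V - k)) 𝓘(ℝ, Model k' (Module.finrank ℂ V - k')) ∞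
      (perp h) := by
  have hT : ContMDiff 𝓘(ℝ, Model k (Module.finrank ℂ V - k)) 𝓘(ℝ, V →L[ℂ] V) ∞
      (fun W : Grass k V ↦ ContinuousLinearMap.id ℂ V - W.carrier.starProjection) :=
    contMDiff_const.sub contMDiff_starProjection
  refine contMDiff_of_range hT fun W ↦ le_antisymm ?_ ?_
  · intro v hv
    refine ⟨v, ?_⟩
    change v - W.carrier.starProjection v = v
    rw [W.carrier.starProjection_apply_eq_zero_iff.2 hv, sub_zero]
  · rintro _ ⟨v, rfl⟩
    exact Submodule.sub_starProjection_mem_orthogonal v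

end Grass

/-! ### Smooth local retractions onto `A_β^i`. -/

section AVarRetract

variable {E : Type*} [NormedAddCommGroup E] [InnerProductSpace ℂ E] {n : ℕ} {β : Fin n → ℕ}

/-- Membership in `A_β^i` only depends on `l_i` and `l_{i+1}`. -/
theorem AVar_congr {i : ℕ} {hi : i + 1 < n} {p q : GrassProd β E}
    (h0 : p ⟨i, by omega⟩ = q ⟨i, by omega⟩) (h1 : p ⟨i + 1, hi⟩ = q ⟨i + 1, hi⟩) :
    p ∈ AVar E β i hi ↔ q ∈ AVar E β i hi := by
  simp only [AVar, Set.mem_ofPred_eq, h0, h1]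

variable [FiniteDimensional ℂ E]

theorem contMDiff_starProjection_eval (k : Fin n) :
    ContMDiff (grassI β E) 𝓘(ℝ, E →L[ℂ] E) ∞
      (fun q : GrassProd β E ↦ ((q k).carrier.starProjection : E →L[ℂ] E)) :=
  Grass.contMDiff_starProjection.comp (contMDiff_eval k)

/-- If `l_a ⟂ l_b` then `l_b` can be moved smoothly with `(l_a, l_b)` so as to remain
perpendicular to `l_a`. -/
theorem exists_smooth_perp_le (a b : Fin n) (p : GrassProd β E)
    (hp : (p a).carrier ⟂ (p b).carrier) :
    ∃ U : Set (GrassProd β E), IsOpen U ∧ p ∈ U ∧ ∃ g : GrassProd β E → Grass (β b) E,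
      ContMDiffOn (grassI β E) 𝓘(ℝ, Grass.Model (β b) (Module.finrank ℂ E - β b)) ∞ g U ∧
      ∀ q ∈ U, (q a).carrier ⟂ (g q).carrier ∧ ((q a).carrier ⟂ (q b).carrier → g q = q b) := by
  -- The operator `(1 - P_a)P_b` has range in `l_a^⊥`, and its range is `l_b` itself when `l_a ⟂
  -- l_b`.
  have hT : ContMDiff (grassI β E) 𝓘(ℝ, E →L[ℂ] E) ∞ (fun q : GrassProd β E ↦
      (ContinuousLinearMap.id ℂ E - (q a).carrier.starProjection).comp
        ((q b).carrier.starProjection)) :=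
    Grass.contMDiff_clm_comp (contMDiff_const.sub (contMDiff_starProjection_eval a))
      (contMDiff_starProjection_eval b)
  obtain ⟨U, hU, hpU, g, hg, -, hgT⟩ := Grass.exists_contMDiffOn_le_range hT p (p b) (by
    intro v hv
    refine ⟨v, ?_⟩
    change (p b).carrier.starProjection v - (p a).carrier.starProjection
      ((p b).carrier.starProjection v) = v
    rw [Submodule.starProjection_eq_self_iff.2 hv,
      (p a).carrier.starProjection_apply_eq_zero_iff.2 (hp.symm.le hv), sub_zero])
  refine ⟨U, hU, hpU, g, hg, fun q hq ↦ ⟨?_, fun h ↦ ?_⟩⟩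
  · rw [Submodule.isOrtho_comm]
    refine (hgT q hq).trans ?_
    rintro _ ⟨v, rfl⟩
    exact Submodule.sub_starProjection_mem_orthogonal _
  · refine Grass.ext' (Submodule.eq_of_le_of_finrank_eq ((hgT q hq).trans ?_)
      ((g q).finrank_eq.trans (q b).finrank_eq.symm))
    rintro _ ⟨v, rfl⟩
    have hv : (q b).carrier.starProjection v ∈ (q b).carrier :=
      Submodule.starProjection_apply_mem _ _
    change (q b).carrier.starProjection v - (q a).carrier.starProjection
      ((q b).carrier.starProjection v) ∈ (q b).carrier
    rwa [(q a).carrier.starProjection_apply_eq_zero_iff.2 (h.symm.le hv), sub_zero]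

/-- The condition reads `l_b^⊥ ⊆ l_a`. So `l_b^⊥` is moved inside the range of `P_a(1 - P_b)`, and
the orthogonal complement is taken at the end. -/
theorem exists_smooth_perp_ge (a b : Fin n) (hb : β b ≤ Module.finrank ℂ E) (p : GrassProd β E)
    (hp : (p a).carrierᗮ ⟂ (p b).carrierᗮ) :
    ∃ U : Set (GrassProd β E), IsOpen U ∧ p ∈ U ∧ ∃ g : GrassProd β E → Grass (β b) E,
      ContMDiffOn (grassI β E) 𝓘(ℝ, Grass.Model (β b) (Module.finrank ℂ E - β b)) ∞ g U ∧
      ∀ q ∈ U, (q a).carrierᗮ ⟂ (g q).carrierᗮ ∧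
        ((q a).carrierᗮ ⟂ (q b).carrierᗮ → g q = q b) := by
  have hle : ∀ U W : Submodule ℂ E, Uᗮ ⟂ Wᗮ ↔ Wᗮ ≤ U := fun U W ↦ by
    rw [Submodule.isOrtho_comm, Submodule.isOrtho_iff_le, Submodule.orthogonal_orthogonal]
  rw [hle] at hp
  have hT : ContMDiff (grassI β E) 𝓘(ℝ, E →L[ℂ] E) ∞ (fun q : GrassProd β E ↦
      ((q a).carrier.starProjection).comp
        (ContinuousLinearMap.id ℂ E - (q b).carrier.starProjection)) :=
    Grass.contMDiff_clm_comp (contMDiff_starProjection_eval a)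
      (contMDiff_const.sub (contMDiff_starProjection_eval b))
  have h1 : β b + (Module.finrank ℂ E - β b) = Module.finrank ℂ E := by omega
  have h2 : (Module.finrank ℂ E - β b) + β b = Module.finrank ℂ E := by omega
  obtain ⟨U, hU, hpU, g, hg, -, hgT⟩ :=
    Grass.exists_contMDiffOn_le_range hT p (Grass.perp h1 (p b)) (by
      intro v hv
      refine ⟨v, ?_⟩
      change (p a).carrier.starProjection (v - (p b).carrier.starProjection v) = v
      rw [(p b).carrier.starProjection_apply_eq_zero_iff.2 hv, sub_zero,
        Submodule.starProjection_eq_self_iff.2 (hp hv)])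
  refine ⟨U, hU, hpU, fun q ↦ Grass.perp h2 (g q), (Grass.contMDiff_perp h2).comp_contMDiffOn hg,
    fun q hq ↦ ⟨?_, fun h ↦ ?_⟩⟩
  · rw [hle]
    change (g q).carrierᗮᗮ ≤ _
    rw [Submodule.orthogonal_orthogonal]
    refine (hgT q hq).trans ?_
    rintro _ ⟨v, rfl⟩
    exact Submodule.starProjection_apply_mem _ _
  · rw [hle] at h
    have h3 : g q = Grass.perp h1 (q b) := by
      refine Grass.ext' (Submodule.eq_of_le_of_finrank_eq ((hgT q hq).trans ?_)
        ((g q).finrank_eq.trans (Grass.perp h1 (q b)).finrank_eq.symm))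
      rintro _ ⟨v, rfl⟩
      have hv : v - (q b).carrier.starProjection v ∈ (q b).carrierᗮ :=
        Submodule.sub_starProjection_mem_orthogonal _
      change (q a).carrier.starProjection (v - (q b).carrier.starProjection v) ∈ (q b).carrierᗮ
      rwa [Submodule.starProjection_eq_self_iff.2 (h hv)]
    change Grass.perp h2 (g q) = q b
    rw [h3]
    exact Grass.ext' (Submodule.orthogonal_orthogonal _)

/-- `A_β^i` is locally a smooth retract, by a retraction which changes `l_{i+1}` only. -/
theorem exists_retract_AVar (hβ : ∀ k, β k ≤ Module.finrank ℂ E) (i : ℕ) (hi : i + 1 < n)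
    (p : GrassProd β E) (hp : p ∈ AVar E β i hi) :
    ∃ U : Set (GrassProd β E), IsOpen U ∧ p ∈ U ∧ ∃ r : GrassProd β E → GrassProd β E,
      ContMDiffOn (grassI β E) (grassI β E) ∞ r U ∧ (∀ q ∈ U, r q ∈ AVar E β i hi) ∧
      (∀ q ∈ U, q ∈ AVar E β i hi → r q = q) ∧
      ∀ (q : GrassProd β E) (k : Fin n), k ≠ ⟨i + 1, hi⟩ → r q k = q k := by
  set a : Fin n := ⟨i, by omega⟩ with ha
  set b : Fin n := ⟨i + 1, hi⟩ with hb
  have hab : a ≠ b := by simp [ha, hb]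
  obtain ⟨U, hU, hpU, g, hg, hgA⟩ : ∃ U : Set (GrassProd β E), IsOpen U ∧ p ∈ U ∧
      ∃ g : GrassProd β E → Grass (β b) E,
      ContMDiffOn (grassI β E) 𝓘(ℝ, Grass.Model (β b) (Module.finrank ℂ E - β b)) ∞ g U ∧
      ∀ q ∈ U, Function.update q b (g q) ∈ AVar E β i hi ∧ (q ∈ AVar E β i hi → g q = q b) := by
    by_cases h : β a + β b ≤ Module.finrank ℂ E
    · have hA : ∀ q : GrassProd β E, q ∈ AVar E β i hi ↔ (q a).carrier ⟂ (q b).carrier :=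
        fun q ↦ Iff.of_eq (if_pos h)
      simpa only [hA, Function.update_self, Function.update_of_ne hab] using
        exists_smooth_perp_le a b p ((hA p).1 hp)
    · have hA : ∀ q : GrassProd β E, q ∈ AVar E β i hi ↔ (q a).carrierᗮ ⟂ (q b).carrierᗮ :=
        fun q ↦ Iff.of_eq (if_neg h)
      simpa only [hA, Function.update_self, Function.update_of_ne hab] using
        exists_smooth_perp_ge a b (hβ b) p ((hA p).1 hp)
  refine ⟨U, hU, hpU, fun q ↦ Function.update q b (g q), ?_, fun q hq ↦ (hgA q hq).1,
    fun q hq hqA ↦ Function.update_eq_self_iff.2 ((hgA q hq).2 hqA),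
    fun q k hk ↦ Function.update_of_ne hk _ _⟩
  rw [contMDiffOn_pi_iff]
  intro k
  by_cases hk : k = b
  · subst hk
    simpa only [Function.update_self] using hg
  · simp only [Function.update_of_ne hk]
    exact (contMDiff_eval k).contMDiffOn

theorem isSubmanifold_AVar (hβ : ∀ k, β k ≤ Module.finrank ℂ E) (i : ℕ) (hi : i + 1 < n) :
    IsSubmanifold (grassI β E) (AVar E β i hi) := by
  have := boundaryless_pi
    (I := fun k ↦ 𝓘(ℝ, Grass.Model (β k) (Module.finrank ℂ E - β k)))
  refine isSubmanifold_of_retract fun p hp ↦ ?_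
  obtain ⟨U, hU, hpU, r, hr, hrA, hrq, -⟩ := exists_retract_AVar hβ i hi p hp
  exact ⟨U, hU, hpU, r, hr, hrA, hrq⟩

end AVarRetract

/-! ### Smoothness of `Φ` and of its inverse -/

section Smoothness

attribute [local instance] tailsNormedAddCommGroup tailsInnerProductSpace

variable {E : Type*} [NormedAddCommGroup E] [InnerProductSpace ℂ E] {n : ℕ}

theorem mem_truncTails_succ {v : Tails E} {k : ℕ} (h : zMul E v ∈ TruncTails E k) :
    v ∈ TruncTails E (k + 1) := by
  refine le_truncTails_succ (L := ℂ ∙ v) ?_ (Submodule.mem_span_singleton_self v)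
  rwa [Submodule.map_span, Set.image_singleton, Submodule.span_singleton_le_iff_mem]

theorem truncTails_mono {k l : ℕ} (h : k ≤ l) : TruncTails E k ≤ TruncTails E l :=
  Finsupp.supported_mono (Set.Iio_subset_Iio h)

theorem constTail_mem (k : ℕ) (x : E) : constTail E k x ∈ TruncTails E (k + 1) := by
  rw [constTail_apply]
  exact sum_mem fun i hi ↦ Finsupp.single_mem_supported ℂ x (by simpa using hi)

theorem YVar.chainOf_le_truncTails_top {β : Fin n → ℕ} (q : GrassProd β E) (k : Fin (n + 1)) :
    YVar.chainOf q k ≤ TruncTails E n :=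
  (YVar.chainOf_le_truncTails q k).trans (truncTails_mono (Nat.lt_succ_iff.1 k.2))

variable [FiniteDimensional ℂ E]

/-- This transfers projections to the finite-dimensional space `E ⊗ span(z⁻¹, …, z⁻ⁿ)`, where the
Grassmannians live. -/
theorem coe_starProjection_submoduleOf {L : Submodule ℂ (Tails E)} [L.HasOrthogonalProjection]
    (hL : L ≤ TruncTails E n) (v : TruncTails E n) :
    (((L.submoduleOf (TruncTails E n)).starProjection v : TruncTails E n) : Tails E) =
      L.starProjection v := by
  have h1 : (L.submoduleOf (TruncTails E n)).starProjection v =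
      (⟨L.starProjection v, hL (Submodule.starProjection_apply_mem _ _)⟩ : TruncTails E n) := by
    refine Submodule.eq_starProjection_of_mem_orthogonal ?_ ?_
    · exact Submodule.starProjection_apply_mem L (v : Tails E)
    · intro u hu
      exact Submodule.sub_starProjection_mem_orthogonal (v : Tails E) (u : Tails E) hu
  rw [h1]

variable (E n) in
/-- Multiplication by `z` on `E ⊗ span(z⁻¹, …, z⁻ⁿ)`. -/
def zMulTrunc : TruncTails E n →L[ℂ] TruncTails E n :=
  LinearMap.toContinuousLinearMap ((zMul E).restrict fun _ hv ↦
    zMul_mem_truncTails (truncTails_mono n.le_succ hv))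

variable (E n) in
/-- Truncated multiplication by `z⁻¹` on `E ⊗ span(z⁻¹, …, z⁻ⁿ)`. -/
def zInvTrunc : TruncTails E n →L[ℂ] TruncTails E n :=
  LinearMap.toContinuousLinearMap
    (Finsupp.restrictDom E ℂ (Set.Iio n) ∘ₗ zInv E ∘ₗ (TruncTails E n).subtype)

theorem coe_zInvTrunc (v : TruncTails E n) (hv : zInv E v ∈ TruncTails E n) :
    (zInvTrunc E n v : Tails E) = zInv E v := by
  change ((Finsupp.restrictDom E ℂ (Set.Iio n)) (zInv E v) : Tails E) = _
  rw [Finsupp.restrictDom_apply]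
  exact (Finsupp.filter_eq_self_iff _ _).2 fun k hk ↦ hv (Finsupp.mem_support_iff.2 hk)

variable (E) in
/-- The map `constTail` with values in `E ⊗ span(z⁻¹, …, z⁻ⁿ)`. -/
def constTailTrunc (k : Fin n) : E →L[ℂ] TruncTails E n :=
  LinearMap.toContinuousLinearMap ((constTail E k).codRestrict _ fun x ↦
    truncTails_mono k.2 (constTail_mem k x))

/-- The operator `residueInv` attached to the subspace of `E ⊗ span(z⁻¹, …, z⁻ⁿ)` with orthogonal
projection `P`. -/
def residueInvTrunc (k : Fin n) (P : TruncTails E n →L[ℂ] TruncTails E n) :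
    E →L[ℂ] TruncTails E n :=
  (ContinuousLinearMap.id ℂ _ - P).comp (constTailTrunc E k) -
    (zInvTrunc E n).comp ((ContinuousLinearMap.id ℂ _ - P).comp
      ((zMulTrunc E n).comp (constTailTrunc E k)))

theorem coe_residueInvTrunc (k : Fin n) {L : Submodule ℂ (Tails E)} [L.HasOrthogonalProjection]
    (hL : L ≤ TruncTails E k) (x : E) :
    (residueInvTrunc k (L.submoduleOf (TruncTails E n)).starProjection x : Tails E) =
      residueInv L k x := by
  have hLn : L ≤ TruncTails E n := hL.trans (truncTails_mono k.2.le)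
  set w : TruncTails E n := zMulTrunc E n (constTailTrunc E k x) -
    (L.submoduleOf (TruncTails E n)).starProjection (zMulTrunc E n (constTailTrunc E k x)) with hw
  have hwc : (w : Tails E) = zMul E (constTail E k x) - L.starProjection
      (zMul E (constTail E k x)) := by
    rw [hw, Submodule.coe_sub, coe_starProjection_submoduleOf hLn]
    rfl
  -- `constTail E k x` reaches down to `z^(-(k+1))`, so `w` reaches at most `z⁻ᵏ`. As `k < n`,
  -- `z⁻¹w` stays in the truncated space and the truncation in `zInvTrunc` loses nothing.
  have hwk : (w : Tails E) ∈ TruncTails E k := by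
    rw [hwc]
    exact sub_mem (zMul_mem_truncTails (constTail_mem _ x))
      (hL (Submodule.starProjection_apply_mem _ _))
  have hzw : zInv E w ∈ TruncTails E n :=
    truncTails_mono k.2 (mem_truncTails_succ (by rwa [zMul_zInv]))
  have h1 : residueInvTrunc k (L.submoduleOf (TruncTails E n)).starProjection x =
      (constTailTrunc E k x - (L.submoduleOf (TruncTails E n)).starProjection
        (constTailTrunc E k x)) - zInvTrunc E n w := rfl
  rw [h1, Submodule.coe_sub, Submodule.coe_sub, coe_starProjection_submoduleOf hLn,
    coe_zInvTrunc _ hzw, hwc]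
  rfl

variable {β : Fin n → ℕ}

namespace YVar

/-- A linear map whose range is the next term of the chain. -/
def chainMap (k : Fin n) (P : TruncTails E n →L[ℂ] TruncTails E n) (Q : E →L[ℂ] E) :
    (TruncTails E n × E) →L[ℂ] TruncTails E n :=
  P.comp (ContinuousLinearMap.fst ℂ _ _) +
    ((residueInvTrunc k P).comp Q).comp (ContinuousLinearMap.snd ℂ _ _)

theorem range_chainMap (q : GrassProd β E) (k : Fin n) :
    (chainOf q k.succ).submoduleOf (TruncTails E n) =
      (chainMap k ((chainOf q k.castSucc).submoduleOf (TruncTails E n)).starProjection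
        (q k).carrier.starProjection : (TruncTails E n × E) →ₗ[ℂ] TruncTails E n).range := by
  set L := chainOf q k.castSucc with hL
  have hz : L.map (zMul E) ≤ L := map_zMul_chainOf_le q _
  have hk : L ≤ TruncTails E k := chainOf_le_truncTails q k.castSucc
  have hLn : L ≤ TruncTails E n := chainOf_le_truncTails_top q k.castSucc
  have hcoe : ∀ (v : TruncTails E n) (x : E),
      ((chainMap k (L.submoduleOf (TruncTails E n)).starProjection
        (q k).carrier.starProjection (v, x) : TruncTails E n) : Tails E) =
      L.starProjection v + residueInv L k ((q k).carrier.starProjection x) := by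
    intro v x
    rw [← coe_residueInvTrunc k hk, ← coe_starProjection_submoduleOf hLn]
    rfl
  ext u
  change (u : Tails E) ∈ L ⊔ chainStep L (q k).carrier ↔ _
  constructor
  · intro hu
    obtain ⟨a, ha, b, hb, hab⟩ := Submodule.mem_sup.1 hu
    obtain ⟨x, hx, rfl⟩ := (mem_chainStep_iff hz hk _ _).1 hb
    refine ⟨(⟨a, hLn ha⟩, x), Subtype.ext ((hcoe _ _).trans ?_)⟩
    rw [← hab, Submodule.starProjection_eq_self_iff.2 ha, Submodule.starProjection_eq_self_iff.2 hx]
  · rintro ⟨⟨v, x⟩, rfl⟩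
    refine (congrArg (· ∈ L ⊔ chainStep L (q k).carrier) (hcoe v x)).mpr ?_
    exact Submodule.add_mem_sup (Submodule.starProjection_apply_mem _ _)
      ((mem_chainStep_iff hz hk _ _).2
        ⟨_, Submodule.starProjection_apply_mem _ _, rfl⟩)

theorem contMDiff_toGrass_of_starProjection (k : Fin n)
    (h : ContMDiff (grassI β E) 𝓘(ℝ, TruncTails E n →L[ℂ] TruncTails E n) ∞
      (fun q : GrassProd β E ↦
        ((chainOf q k.castSucc).submoduleOf (TruncTails E n)).starProjection)) :
    ContMDiff (grassI β E) 𝓘(ℝ, Grass.Model (Fin.partialSum β k.succ)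
      (Module.finrank ℂ (TruncTails E n) - Fin.partialSum β k.succ)) ∞
      (fun q : GrassProd β E ↦ (ofGrassProd q).toGrass k) := by
  refine Grass.contMDiff_of_range (T := fun q : GrassProd β E ↦ chainMap k
    ((chainOf q k.castSucc).submoduleOf (TruncTails E n)).starProjection
    (q k).carrier.starProjection) ?_ fun q ↦ range_chainMap q k
  have hid : ContMDiff (grassI β E) 𝓘(ℝ, TruncTails E n →L[ℂ] TruncTails E n) ∞
      (fun q : GrassProd β E ↦ ContinuousLinearMap.id ℂ (TruncTails E n) -
        ((chainOf q k.castSucc).submoduleOf (TruncTails E n)).starProjection) :=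
    contMDiff_const.sub h
  have hinv : ContMDiff (grassI β E) 𝓘(ℝ, E →L[ℂ] TruncTails E n) ∞
      (fun q : GrassProd β E ↦ residueInvTrunc k
        ((chainOf q k.castSucc).submoduleOf (TruncTails E n)).starProjection) :=
    (Grass.contMDiff_clm_comp hid contMDiff_const).sub
      (Grass.contMDiff_clm_comp contMDiff_const (Grass.contMDiff_clm_comp hid contMDiff_const))
  exact (Grass.contMDiff_clm_comp h contMDiff_const).add (Grass.contMDiff_clm_comp
    (Grass.contMDiff_clm_comp hinv (contMDiff_starProjection_eval k)) contMDiff_const)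

/-- Induction along the chain: a smooth projection onto one term makes the next term a smooth point
of its Grassmannian, whose projection is then smooth again. -/
theorem contMDiff_starProjection_chainOf (k : Fin (n + 1)) :
    ContMDiff (grassI β E) 𝓘(ℝ, TruncTails E n →L[ℂ] TruncTails E n) ∞
      (fun q : GrassProd β E ↦
        ((chainOf q k).submoduleOf (TruncTails E n)).starProjection) := by
  induction k using Fin.induction with
  | zero =>
    exact contMDiff_const
      (c := ((⊥ : Submodule ℂ (Tails E)).submoduleOf (TruncTails E n)).starProjection)
  | succ k ih =>
    have h1 := contMDiff_toGrass_of_starProjection k ih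
    have h2 : ContMDiff 𝓘(ℝ, Grass.Model (Fin.partialSum β k.succ)
        (Module.finrank ℂ (TruncTails E n) - Fin.partialSum β k.succ))
        𝓘(ℝ, TruncTails E n →L[ℂ] TruncTails E n) ∞
        (fun W : Grass (Fin.partialSum β k.succ) (TruncTails E n) ↦ W.carrier.starProjection) :=
      Grass.contMDiff_starProjection
    have h3 : ContMDiff (grassI β E) 𝓘(ℝ, TruncTails E n →L[ℂ] TruncTails E n) ∞
        (fun q : GrassProd β E ↦ ((ofGrassProd q).toGrass k).carrier.starProjection) := h2.comp h1
    have h4 : ∀ q : GrassProd β E, ((ofGrassProd q).toGrass k).carrier.starProjection =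
        ((chainOf q k.succ).submoduleOf (TruncTails E n)).starProjection := fun q ↦ rfl
    simpa only [h4] using h3

/-- The inverse of `Φ` is smooth. -/
theorem contMDiff_toGrass_ofGrassProd :
    ContMDiff (grassI β E) (grassI (fun k : Fin n ↦ Fin.partialSum β k.succ) (TruncTails E n)) ∞
      (fun q : GrassProd β E ↦ (ofGrassProd q).toGrass) :=
  contMDiff_pi_iff.2 fun k ↦
    contMDiff_toGrass_of_starProjection k (contMDiff_starProjection_chainOf k.castSucc)

/-- The orthogonal projections onto the terms of a chain, including the zeroth. -/
def projections (l : GrassProd (fun k : Fin n ↦ Fin.partialSum β k.succ) (TruncTails E n)) :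
    Fin (n + 1) → TruncTails E n →L[ℂ] TruncTails E n :=
  Fin.cases 0 fun k ↦ (l k).carrier.starProjection

theorem contMDiff_projections (k : Fin (n + 1)) :
    ContMDiff (grassI (fun k : Fin n ↦ Fin.partialSum β k.succ) (TruncTails E n))
      𝓘(ℝ, TruncTails E n →L[ℂ] TruncTails E n) ∞
      (fun l : GrassProd (fun k : Fin n ↦ Fin.partialSum β k.succ) (TruncTails E n) ↦
        projections l k) := by
  refine Fin.cases ?_ (fun k ↦ ?_) k
  · exact contMDiff_const
  · exact Grass.contMDiff_starProjection.comp (contMDiff_eval k)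

theorem projections_toGrass (y : YVar E β) (k : Fin (n + 1)) (v : TruncTails E n) :
    ((projections y.toGrass k v : TruncTails E n) : Tails E) = (y.L k).starProjection v := by
  rw [← coe_starProjection_submoduleOf (y.le_trunc_top k)]
  refine Fin.cases ?_ (fun k ↦ ?_) k
  · have h : (y.L 0).submoduleOf (TruncTails E n) = ⊥ := by
      rw [y.zero_eq]
      exact Submodule.ker_subtype _
    rw [(Submodule.starProjection_apply_eq_zero_iff _).2]
    · rfl
    · rw [h, Submodule.bot_orthogonal_eq_top]
      trivial
  · rfl

/-- The piece `L_k ∩ L_{k-1}^⊥` is the range of `(1 - P_{k-1})P_k`. This operator is defined for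
arbitrary tuples of subspaces, not only for chains, and so provides the local extension of `Φ`. -/
theorem toGrassProd_eq_range (y : YVar E β) (k : Fin n) : (y.toGrassProd k).carrier =
    ((((LinearMap.toContinuousLinearMap (residueMap E ∘ₗ (TruncTails E n).subtype)).comp
      (ContinuousLinearMap.id ℂ _ - projections y.toGrass k.castSucc)).comp
      (projections y.toGrass k.succ) : TruncTails E n →L[ℂ] E) : TruncTails E n →ₗ[ℂ] E).range := by
  have hcoe : ∀ v : TruncTails E n,
      ((LinearMap.toContinuousLinearMap (residueMap E ∘ₗ (TruncTails E n).subtype)).comp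
      (ContinuousLinearMap.id ℂ _ - projections y.toGrass k.castSucc)).comp
      (projections y.toGrass k.succ) v = residueMap E ((y.L k.succ).starProjection v -
        (y.L k.castSucc).starProjection ((y.L k.succ).starProjection v)) := by
    intro v
    rw [← projections_toGrass y k.succ, ← projections_toGrass y k.castSucc]
    rfl
  ext x
  constructor
  · rintro ⟨w, hw, rfl⟩
    refine ⟨⟨w, y.le_trunc_top _ hw.1⟩, (hcoe _).trans ?_⟩
    rw [Submodule.starProjection_eq_self_iff.2 hw.1,
      (Submodule.starProjection_apply_eq_zero_iff _).2 hw.2, sub_zero]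
  · rintro ⟨v, rfl⟩
    refine ⟨_, ⟨?_, ?_⟩, (hcoe v).symm⟩
    · exact sub_mem (Submodule.starProjection_apply_mem _ _)
        (y.le_succ k (Submodule.starProjection_apply_mem _ _))
    · exact Submodule.sub_starProjection_mem_orthogonal _

/-- `Φ` extends locally to a smooth map. -/
theorem exists_extension_toGrassProd (y : YVar E β) :
    ∃ U : Set (GrassProd (fun k : Fin n ↦ Fin.partialSum β k.succ) (TruncTails E n)),
      IsOpen U ∧ y.toGrass ∈ U ∧
      ∃ F : GrassProd (fun k : Fin n ↦ Fin.partialSum β k.succ) (TruncTails E n) → GrassProd β E,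
        ContMDiffOn (grassI (fun k : Fin n ↦ Fin.partialSum β k.succ) (TruncTails E n))
          (grassI β E) ∞ F U ∧ ∀ x : YVar E β, x.toGrass ∈ U → F x.toGrass = x.toGrassProd := by
  have key : ∀ k : Fin n,
      ∃ U : Set (GrassProd (fun k : Fin n ↦ Fin.partialSum β k.succ) (TruncTails E n)),
      IsOpen U ∧ y.toGrass ∈ U ∧
      ∃ f : GrassProd (fun k : Fin n ↦ Fin.partialSum β k.succ) (TruncTails E n) → Grass (β k) E,
        ContMDiffOn (grassI (fun k : Fin n ↦ Fin.partialSum β k.succ) (TruncTails E n))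
          𝓘(ℝ, Grass.Model (β k) (Module.finrank ℂ E - β k)) ∞ f U ∧
        ∀ x : YVar E β, x.toGrass ∈ U → f x.toGrass = x.toGrassProd k := by
    intro k
    have hT := Grass.contMDiff_clm_comp (Grass.contMDiff_clm_comp
      (contMDiff_const (c := LinearMap.toContinuousLinearMap
        (residueMap E ∘ₗ (TruncTails E n).subtype)))
      ((contMDiff_const (c := ContinuousLinearMap.id ℂ (TruncTails E n))).sub
        (contMDiff_projections (β := β) (E := E) k.castSucc)))
      (contMDiff_projections (β := β) (E := E) k.succ)
    obtain ⟨U, hU, hyU, f, hf, -, hfT⟩ := Grass.exists_contMDiffOn_le_range hT y.toGrass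
      (y.toGrassProd k) (y.toGrassProd_eq_range k).le
    refine ⟨U, hU, hyU, f, hf, fun x hx ↦ Grass.ext' (Submodule.eq_of_le_of_finrank_eq ?_
      ((f _).finrank_eq.trans (x.toGrassProd k).finrank_eq.symm))⟩
    exact (hfT _ hx).trans (x.toGrassProd_eq_range k).ge
  choose U hU hyU f hf hfx using key
  refine ⟨⋂ k, U k, isOpen_iInter_of_finite hU, Set.mem_iInter.2 hyU, fun l k ↦ f k l,
    contMDiffOn_pi_iff.2 fun k ↦ (hf k).mono (Set.iInter_subset U k),
    fun x hx ↦ funext fun k ↦ hfx k x (Set.mem_iInter.1 hx k)⟩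

end YVar

end Smoothness

/-! ### Velocities of curves -/

section Velocity

variable {E : Type*} [NormedAddCommGroup E] [NormedSpace ℝ E] {H : Type*} [TopologicalSpace H]
  {I : ModelWithCorners ℝ E H} {M : Type*} [TopologicalSpace M] [ChartedSpace H M]
  {E' : Type*} [NormedAddCommGroup E'] [NormedSpace ℝ E'] {H' : Type*} [TopologicalSpace H']
  {J : ModelWithCorners ℝ E' H'} {N : Type*} [TopologicalSpace N] [ChartedSpace H' N]

variable (I) in
/-- The velocity of a curve at time `0`. -/
def velocity (c : ℝ → M) : E := mfderiv 𝓘(ℝ, ℝ) I c 0 (1 : ℝ)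

/-- A single linear map serves all curves through `x`, so sums of velocities can be transported by
`ψ`. -/
theorem exists_velocity_comp {ψ : N → M} (hψ : ContMDiff J I ∞ ψ) (x : N) :
    ∃ D : E' →L[ℝ] E, ∀ c : ℝ → N, MDifferentiableAt 𝓘(ℝ, ℝ) J c 0 → c 0 = x →
      velocity I (ψ ∘ c) = D (velocity J c) := by
  refine ⟨by exact mfderiv J I ψ x, ?_⟩
  rintro c hc rfl
  rw [velocity, mfderiv_comp 0 ((hψ _).mdifferentiableAt (by simp)) hc]
  rfl

theorem velocity_congr {c c' : ℝ → M} (h : c =ᶠ[𝓝 0] c') : velocity I c = velocity I c' := by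
  rw [velocity, h.mfderiv_eq]
  rfl

theorem velocity_const (x : M) : velocity I (fun _ ↦ x) = 0 := by
  rw [velocity, mfderiv_const]
  rfl

theorem mem_tangentVectors {S : Set M} {c : ℝ → M} {O : Set ℝ} (hO : IsOpen O) (h0 : 0 ∈ O)
    (hc : ContMDiffOn 𝓘(ℝ, ℝ) I ∞ c O) (hcS : ∀ t ∈ O, c t ∈ S) {x : M} (hx : c 0 = x) :
    (velocity I c : E) ∈ (tangentVectors I S x : Set E) := by
  obtain ⟨ε, hε, hεO⟩ := Metric.isOpen_iff.1 hO 0 h0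
  rw [Real.ball_eq_Ioo, zero_sub, zero_add] at hεO
  exact ⟨c, ε, hε, hc.mono hεO, fun t ht ↦ hcS t (hεO ht), hx, rfl⟩

/-- Every tangent vector is the velocity of a smooth curve. -/
theorem exists_curve_velocity [I.Boundaryless] [IsManifold I ∞ M] (x : M) (δ : E) :
    ∃ (c : ℝ → M) (O : Set ℝ), IsOpen O ∧ 0 ∈ O ∧ ContMDiffOn 𝓘(ℝ, ℝ) I ∞ c O ∧ c 0 = x ∧
      velocity I c = δ := by
  set e := extChartAt I x with he
  let l : ℝ → E := fun t ↦ e x + t • δ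
  have hl : ContDiff ℝ ∞ l := contDiff_const.add (contDiff_id.smul contDiff_const)
  have hl0 : l 0 = e x := by simp [l]
  have hO : IsOpen (l ⁻¹' e.target) := (isOpen_extChartAt_target x).preimage hl.continuous
  have h0 : (0 : ℝ) ∈ l ⁻¹' e.target := by
    rw [Set.mem_preimage, hl0]; exact mem_extChartAt_target x
  have hc : ContMDiffOn 𝓘(ℝ, ℝ) I ∞ (e.symm ∘ l) (l ⁻¹' e.target) :=
    (contMDiffOn_extChartAt_symm x).comp hl.contMDiff.contMDiffOn fun t ht ↦ ht
  have hc0 : (e.symm ∘ l) 0 = x := by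
    rw [Function.comp_apply, hl0]; exact extChartAt_to_inv x
  refine ⟨e.symm ∘ l, _, hO, h0, hc, hc0, ?_⟩
  have h1 : HasMFDerivAt 𝓘(ℝ, ℝ) I (e.symm ∘ l) 0
      ((ContinuousLinearMap.toSpanSingleton ℝ δ : ℝ →L[ℝ] E)) := by
    refine ⟨(hc.contMDiffAt (hO.mem_nhds h0)).continuousAt, ?_⟩
    have h2 : HasFDerivAt l (ContinuousLinearMap.toSpanSingleton ℝ δ) 0 := by
      have h3 : HasDerivAt l ((1 : ℝ) • δ) 0 := ((hasDerivAt_id (0 : ℝ)).smul_const δ).const_add _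
      rw [one_smul] at h3
      exact h3.hasFDerivAt
    have h4 : writtenInExtChartAt 𝓘(ℝ, ℝ) I 0 (e.symm ∘ l) =ᶠ[𝓝 0] l := by
      filter_upwards [hO.mem_nhds h0] with t ht
      rw [writtenInExtChartAt, hc0]
      exact e.right_inv ht
    exact (h2.congr_of_eventuallyEq h4).hasFDerivWithinAt
  rw [velocity, h1.mfderiv]
  exact one_smul ℝ δ

end Velocity

/-! ### Transversality -/

section Transversality

variable {E : Type*} [NormedAddCommGroup E] [InnerProductSpace ℂ E] [FiniteDimensional ℂ E]
  {n : ℕ} {β : Fin n → ℕ}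

/-- The infinitesimal form of the transversality of `A_β^i` and `A_β^j`: every curve through a point
of the intersection has the same velocity as a sum of two curves in `A_β^i` and `A_β^j`. -/
theorem exists_curves_AVar (hβ : ∀ k, β k ≤ Module.finrank ℂ E) {i j : ℕ} (hi : i + 1 < n)
    (hj : j + 1 < n) (hij : i < j) {q : GrassProd β E} (hqi : q ∈ AVar E β i hi)
    (hqj : q ∈ AVar E β j hj) {c : ℝ → GrassProd β E} {O : Set ℝ} (hO : IsOpen O) (h0 : 0 ∈ O)
    (hc : ContMDiffOn 𝓘(ℝ, ℝ) (grassI β E) ∞ c O) (hcq : c 0 = q) :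
    ∃ (a b : ℝ → GrassProd β E) (O' : Set ℝ), IsOpen O' ∧ 0 ∈ O' ∧
      ContMDiffOn 𝓘(ℝ, ℝ) (grassI β E) ∞ a O' ∧ ContMDiffOn 𝓘(ℝ, ℝ) (grassI β E) ∞ b O' ∧
      (∀ t ∈ O', a t ∈ AVar E β i hi) ∧ (∀ t ∈ O', b t ∈ AVar E β j hj) ∧ a 0 = q ∧ b 0 = q ∧
      velocity (grassI β E) a + velocity (grassI β E) b = velocity (grassI β E) c := by
  set s : Fin n := ⟨j + 1, hj⟩ with hs
  -- The curve in `A_β^j` is `r ∘ c`, which agrees with `c` in every factor except that of index `s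
  -- = j + 1`.
  obtain ⟨U, hU, hqU, r, hr, hrA, hrq, hrk⟩ := exists_retract_AVar hβ j hj q hqj
  have hOb : IsOpen (O ∩ c ⁻¹' U) := hc.continuousOn.isOpen_inter_preimage hO hU
  have h0b : (0 : ℝ) ∈ O ∩ c ⁻¹' U := ⟨h0, by rw [Set.mem_preimage, hcq]; exact hqU⟩
  have hb : ContMDiffOn 𝓘(ℝ, ℝ) (grassI β E) ∞ (r ∘ c) (O ∩ c ⁻¹' U) :=
    hr.comp (hc.mono Set.inter_subset_left) fun t ht ↦ ht.2
  -- The missing velocity lies in the factor `s`; it is realized by a curve `h` in that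
  -- Grassmannian, all other factors staying fixed at `q`.
  obtain ⟨h, Oh, hOh, h0h, hh, hhq, hhv⟩ := exists_curve_velocity
    (I := 𝓘(ℝ, Grass.Model (β s) (Module.finrank ℂ E - β s))) (q s)
    ((velocity (grassI β E) c - velocity (grassI β E) (r ∘ c)) s)
  have ha : ContMDiffOn 𝓘(ℝ, ℝ) (grassI β E) ∞ (fun t ↦ Function.update q s (h t)) Oh := by
    rw [contMDiffOn_pi_iff]
    intro k
    by_cases hk : k = s
    · subst hk
      simpa only [Function.update_self] using hh
    · simp only [Function.update_of_ne hk]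
      exact contMDiffOn_const
  have ha0 : Function.update q s (h 0) = q := by rw [hhq, Function.update_eq_self]
  refine ⟨fun t ↦ Function.update q s (h t), r ∘ c, (O ∩ c ⁻¹' U) ∩ Oh, hOb.inter hOh, ⟨h0b, h0h⟩,
    ha.mono Set.inter_subset_right, hb.mono Set.inter_subset_left, fun t _ ↦ ?_,
    fun t ht ↦ hrA _ ht.1.2, ha0, by rw [Function.comp_apply, hcq, hrq q hqU hqj], ?_⟩
  -- `A_β^i` involves the factors `i` and `i + 1 ≤ j` only, so moving the factor `j + 1` keeps the
  -- curve inside it.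
  · refine (AVar_congr ?_ ?_).2 hqi <;> refine Function.update_of_ne ?_ _ _ <;>
      rw [hs, Ne, Fin.mk.injEq] <;> omega
  · have hmd : ∀ {d : ℝ → GrassProd β E} {O : Set ℝ}, IsOpen O → 0 ∈ O →
        ContMDiffOn 𝓘(ℝ, ℝ) (grassI β E) ∞ d O → ∀ k, velocity (grassI β E) d k =
          velocity 𝓘(ℝ, Grass.Model (β k) (Module.finrank ℂ E - β k)) (fun t ↦ d t k) :=
      fun hO h0 hd k ↦ mfderiv_pi_apply
        ((hd.contMDiffAt (hO.mem_nhds h0)).mdifferentiableAt (by simp)) k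
    funext k
    rw [Pi.add_apply]
    by_cases hk : k = s
    · subst hk
      rw [hmd hOh h0h ha]
      simp only [Function.update_self]
      rw [hhv, Pi.sub_apply, sub_add_cancel]
    · rw [hmd hOh h0h ha, hmd hOb h0b hb, hmd hO h0 hc]
      simp only [Function.update_of_ne hk]
      rw [velocity_const, zero_add]
      simp only [Function.comp_apply, hrk _ k hk]

/-! ### Transfer from `∏ Gr(β_k, E)` to `Y_β`. -/

namespace YVar

theorem toGrass_image_eq (S : Set (YVar E β)) : toGrass '' S =
    (fun q ↦ (ofGrassProd q).toGrass) '' (equivGrassProd E β '' S) := by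
  rw [Set.image_image]
  exact Set.image_congr fun y _ ↦ congrArg toGrass ((equivGrassProd E β).symm_apply_apply y).symm

/-- The curve is sent to `∏ Gr(β_k, E)` by a local extension of `Φ`, its velocity is decomposed
there, and the derivative of `Φ⁻¹` carries the decomposition back. -/
theorem meetTransversely_of_lt (hβ : ∀ k, β k ≤ Module.finrank ℂ E) {i j : ℕ} (hi : i + 1 < n)
    (hj : j + 1 < n) (hij : i < j) :
    MeetTransversely (grassI (fun k : Fin n ↦ Fin.partialSum β k.succ) (TruncTails E n))
      (Set.range (toGrass : YVar E β → _)) (toGrass '' XVar E β i hi)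
      (toGrass '' XVar E β j hj) := by
  set I := grassI (fun k : Fin n ↦ Fin.partialSum β k.succ) (TruncTails E n) with hI
  rintro _ ⟨⟨y, hyi, rfl⟩, ⟨y', hyj, hy'⟩⟩ v ⟨γ, ε, hε, hγ, hγY, hγ0, hv⟩
  obtain rfl := toGrass_injective hy'
  obtain ⟨U, hU, hyU, F, hF, hFΦ⟩ := exists_extension_toGrassProd y'
  set ψ := fun q : GrassProd β E ↦ (ofGrassProd q).toGrass with hψ
  have hψs : ContMDiff (grassI β E) I ∞ ψ := contMDiff_toGrass_ofGrassProd
  have hψΦ : ∀ x : YVar E β, ψ x.toGrassProd = x.toGrass := fun x ↦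
    congrArg toGrass ((equivGrassProd E β).symm_apply_apply x)
  have hO : IsOpen (Set.Ioo (-ε) ε ∩ γ ⁻¹' U) :=
    hγ.continuousOn.isOpen_inter_preimage isOpen_Ioo hU
  have h0 : (0 : ℝ) ∈ Set.Ioo (-ε) ε ∩ γ ⁻¹' U :=
    ⟨by simp [hε], by rw [Set.mem_preimage, hγ0]; exact hyU⟩
  have hc : ContMDiffOn 𝓘(ℝ, ℝ) (grassI β E) ∞ (F ∘ γ) (Set.Ioo (-ε) ε ∩ γ ⁻¹' U) :=
    hF.comp (hγ.mono Set.inter_subset_left) fun t ht ↦ ht.2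
  have hcq : (F ∘ γ) 0 = y'.toGrassProd := by rw [Function.comp_apply, hγ0, hFΦ y' hyU]
  -- `γ` runs in `Y_β`, where `F` agrees with `Φ`, so `Φ⁻¹ ∘ F` fixes it near time `0`.
  have hψc : γ =ᶠ[𝓝 0] ψ ∘ (F ∘ γ) := by
    filter_upwards [hO.mem_nhds h0] with t ht
    obtain ⟨x, hx⟩ := hγY t ht.1
    have hxU : x.toGrass ∈ U := by rw [hx]; exact ht.2
    simp only [Function.comp_apply]
    rw [← hx, hFΦ x hxU, hψΦ]
  obtain ⟨a, b, O', hO', h0', ha, hb, haA, hbA, ha0, hb0, hab⟩ := exists_curves_AVar hβ hi hj hij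
    ((mem_XVar_iff _ _ _).1 hyi) ((mem_XVar_iff _ _ _).1 hyj) hO h0 hc hcq
  have hmd : ∀ {d : ℝ → GrassProd β E} {O : Set ℝ}, IsOpen O → 0 ∈ O →
      ContMDiffOn 𝓘(ℝ, ℝ) (grassI β E) ∞ d O → MDifferentiableAt 𝓘(ℝ, ℝ) (grassI β E) d 0 :=
    fun hO h0 hd ↦ (hd.contMDiffAt (hO.mem_nhds h0)).mdifferentiableAt (by simp)
  have hmem : ∀ (l : ℕ) (hl : l + 1 < n) (d : ℝ → GrassProd β E),
      ContMDiffOn 𝓘(ℝ, ℝ) (grassI β E) ∞ d O' → (∀ t ∈ O', d t ∈ AVar E β l hl) →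
      d 0 = y'.toGrassProd → (velocity I (ψ ∘ d) : GrassProd.Model _ _) ∈
        (tangentVectors I (toGrass '' XVar E β l hl) y'.toGrass : Set (GrassProd.Model _ _)) := by
    intro l hl d hd hdA hd0
    refine mem_tangentVectors hO' h0' (hψs.comp_contMDiffOn hd) (fun t ht ↦ ?_) ?_
    · rw [toGrass_image_eq, image_XVar]
      exact ⟨d t, hdA t ht, rfl⟩
    · rw [Function.comp_apply, hd0, hψΦ]
  refine ⟨_, hmem i hi a ha haA ha0, _, hmem j hj b hb hbA hb0, ?_⟩
  obtain ⟨D, hD⟩ := exists_velocity_comp hψs y'.toGrassProd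
  have hsum : velocity I (ψ ∘ a) + velocity I (ψ ∘ b) = velocity I γ := by
    rw [velocity_congr hψc, hD _ (hmd hO h0 hc) hcq, hD _ (hmd hO' h0' ha) ha0,
      hD _ (hmd hO' h0' hb) hb0, ← hab, map_add]
  exact hsum.trans hv

/-- If `r` retracts onto `Φ(S)` and `F` is a local extension of `Φ`, then `Φ⁻¹ ∘ r ∘ F` retracts
onto `S`. -/
theorem isSubmanifold_of_image (S : Set (YVar E β))
    (h : ∀ p ∈ equivGrassProd E β '' S, ∃ U : Set (GrassProd β E), IsOpen U ∧ p ∈ U ∧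
      ∃ r : GrassProd β E → GrassProd β E, ContMDiffOn (grassI β E) (grassI β E) ∞ r U ∧
      (∀ q ∈ U, r q ∈ equivGrassProd E β '' S) ∧
      ∀ q ∈ U, q ∈ equivGrassProd E β '' S → r q = q) :
    IsSubmanifold (grassI (fun k : Fin n ↦ Fin.partialSum β k.succ) (TruncTails E n))
      (toGrass '' S) := by
  have := boundaryless_pi (I := fun k : Fin n ↦ 𝓘(ℝ, Grass.Model (Fin.partialSum β k.succ)
    (Module.finrank ℂ (TruncTails E n) - Fin.partialSum β k.succ)))
  refine isSubmanifold_of_retract ?_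
  rintro _ ⟨y, hy, rfl⟩
  obtain ⟨U, hU, hyU, F, hF, hFΦ⟩ := exists_extension_toGrassProd y
  obtain ⟨U', hU', hyU', r, hr, hrS, hrq⟩ := h _ (Set.mem_image_of_mem _ hy)
  refine ⟨U ∩ F ⁻¹' U', hF.continuousOn.isOpen_inter_preimage hU hU', ⟨hyU, ?_⟩,
    fun l ↦ (ofGrassProd (r (F l))).toGrass, ?_, ?_, ?_⟩
  · rw [Set.mem_preimage, hFΦ y hyU]
    exact hyU'
  · exact contMDiff_toGrass_ofGrassProd.comp_contMDiffOn
      (hr.comp (hF.mono Set.inter_subset_left) fun l hl ↦ hl.2)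
  · intro l hl
    rw [toGrass_image_eq]
    exact ⟨_, hrS _ hl.2, rfl⟩
  · rintro _ hl ⟨x, hx, rfl⟩
    have h1 : F x.toGrass = x.toGrassProd := hFΦ x hl.1
    have h2 : r x.toGrassProd = x.toGrassProd :=
      hrq _ (by rw [← h1]; exact hl.2) (Set.mem_image_of_mem _ hx)
    change (ofGrassProd (r (F x.toGrass))).toGrass = x.toGrass
    rw [h1, h2]
    exact congrArg toGrass ((equivGrassProd E β).symm_apply_apply x)

end YVar

end Transversality

end

theorem theorem3p1 {E : Type*} [NormedAddCommGroup E] [InnerProductSpace ℂ E]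
    [FiniteDimensional ℂ E] {n : ℕ} (β : Fin n → ℕ)
    (hβ : ∀ k, 1 ≤ β k ∧ β k < Module.finrank ℂ E) :
    -- `Y_β` and the `X_β^i` are submanifolds
    IsSubmanifold (grassI (fun k : Fin n ↦ Fin.partialSum β k.succ) (TruncTails E n))
      (Set.range (YVar.toGrass : YVar E β → _)) ∧
    (∀ (i : ℕ) (hi : i + 1 < n),
      IsSubmanifold (grassI (fun k : Fin n ↦ Fin.partialSum β k.succ) (TruncTails E n))
        (YVar.toGrass '' XVar E β i hi)) ∧
    -- the diffeomorphism
    (∃ Φ : YVar E β ≃ GrassProd β E,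
      IsDiffeoOfSubmanifold (grassI (fun k : Fin n ↦ Fin.partialSum β k.succ) (TruncTails E n))
        (grassI β E) YVar.toGrass Φ ∧
      (∀ (y : YVar E β) (k : Fin n),
        (Φ y k).carrier = (perpIn (y.L k.castSucc) (y.L k.succ)).map (residueMap E)) ∧
      ∀ (i : ℕ) (hi : i + 1 < n),
        IsSubmanifold (grassI β E) (AVar E β i hi) ∧ Φ '' XVar E β i hi = AVar E β i hi) ∧
    -- transversality
    ∀ (i j : ℕ) (hi : i + 1 < n) (hj : j + 1 < n), i ≠ j →
      MeetTransversely (grassI (fun k : Fin n ↦ Fin.partialSum β k.succ) (TruncTails E n))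
        (Set.range (YVar.toGrass : YVar E β → _))
        (YVar.toGrass '' XVar E β i hi) (YVar.toGrass '' XVar E β j hj) := by
  have hβ' : ∀ k, β k ≤ Module.finrank ℂ E := fun k ↦ (hβ k).2.le
  refine ⟨?_, fun i hi ↦ ?_, ⟨YVar.equivGrassProd E β,
    ⟨YVar.exists_extension_toGrassProd, YVar.contMDiff_toGrass_ofGrassProd⟩, fun _ _ ↦ rfl,
    fun i hi ↦ ⟨isSubmanifold_AVar hβ' i hi, YVar.image_XVar i hi⟩⟩, fun i j hi hj hij ↦ ?_⟩
  · rw [← Set.image_univ]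
    -- As `Φ` is onto, the identity serves as the retraction for `Y_β` itself.
    refine YVar.isSubmanifold_of_image _ fun p _ ↦
      ⟨Set.univ, isOpen_univ, trivial, id, contMDiffOn_id, fun q _ ↦ ?_, fun _ _ _ ↦ rfl⟩
    rw [Set.image_univ, (YVar.equivGrassProd E β).range_eq_univ]
    trivial
  · refine YVar.isSubmanifold_of_image _ ?_
    rw [YVar.image_XVar]
    intro p hp
    obtain ⟨U, hU, hpU, r, hr, hrA, hrq, -⟩ := exists_retract_AVar hβ' i hi p hp
    exact ⟨U, hU, hpU, r, hr, hrA, hrq⟩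
  · rcases lt_or_gt_of_ne hij with h | h
    · exact YVar.meetTransversely_of_lt hβ' hi hj h
    · intro p hp v hv
      obtain ⟨u, hu, w, hw, huw⟩ := YVar.meetTransversely_of_lt hβ' hj hi h p hp.symm v hv
      exact ⟨w, hw, u, hu, (add_comm w u).trans huw⟩
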